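/- Let $q\ge 2$ be an integer and let $\mathfrak X$ be (the vertex set of) the homogeneous tree of degree $q+1$, i.e. a connected graph without circuits in which every vertex has $q+1$ neighbours, with its graph distance $d$ and the counting measure. Fix a vertex $o$ and put $|x|=d(o,x)$. Let $\Omega$ be the set of infinite geodesic rays $\omega=(\omega_0,\omega_1,\dots)$ with $\omega_0=o$, with the $\sigma$-algebra generated by the sets $E(x)=\{\omega\in\Omega: x \text{ lies on } \omega\}$, $x\in\mathfrak X$, and let $\nu$ be the probability measure on $\Omega$ with $\nu(E(x))=\frac{q}{(q+1)q^{|x|}}$ for $x\ne o$ (the unique probability measure invariant under the automorphisms of $\mathfrak X$ fixing $o$). The height functions are $h_\omega(x)=\lim_{m\to\infty}(m-d(x,\omega_m))$. Let $\tau=\pi/\log q$, and let $\mu$ be the Plancherel measure on $[0,\tau]$, $$d\mu(s)=c_P\,|c(s)|^{-2}\,ds,\qquad c(z)=\frac{q^{1/2}}{q+1}\,\frac{q^{1/2+iz}-q^{-1/2-iz}}{q^{iz}-q^{-iz}},\qquad c_P=\frac{q\log q}{2\pi(q+1)},$$ which is normalized so that $\mu([0,\tau])=1$. For a finitely supported $f:\mathfrak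 X\to\mathbb C$ put $\mathcal Hf(\omega,s)=\sum_{y\in\mathfrak X}f(y)\,q^{(\frac12+is)h_\omega(y)}$. Let $\sigma:\mathfrak X\times\Omega\times[0,\tau]\to\mathbb C$ be measurable. The pseudo-differential operator $T_\sigma$ is given on finitely supported functions by $$T_\sigma f(x)=\int_\Omega\int_0^\tau q^{(\frac12-is)h_\omega(x)}\,\sigma(x,\omega,s)\,\mathcal Hf(\omega,s)\,d\mu(s)\,d\nu(\omega),\qquad x\in\mathfrak X.$$ We say that $T_\sigma$ is a bounded operator on $L^2(\mathfrak X)$ if these integrals converge absolutely over $\Omega\times[0,\tau]$ for all finitely supported $f$ and all $x$, and $f\mapsto T_\sigma f$ extends to a (then unique) bounded linear operator on $L^2(\mathfrak X)$, again denoted $T_\sigma$. It is Hilbert–Schmidt if moreover it is compact and $\|T_\sigma\|_{S_2}=\big(\sum_n s_n(T_\sigma)^2\big)^{1/2}<\infty$, where the $s_n(T_\sigma)$ are the eigenvalues of $|T_\sigma|=\sqrt{T_\sigma^*T_\sigma}$ counted with multiplicity. Put $b(x,\omega,s)=\overline{\sigma(x,\omega,s)}\,q^{(\frac12+is)h_\omega(x)}$.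 Then $T_\sigma$ is a Hilbert–Schmidt operator on $L^2(\mathfrak X)$ if and only if $b\in L^2(\mathfrak X\times\Omega\times[0,\tau])$, with respect to the product of the counting measure, $\nu$ and $\mu$. Moreover, in this case, $$\|T_\sigma\|_{S_2}=\|b\|_{L^2(\mathfrak X\times\Omega\times[0,\tau])}.$$ -/

import Mathlib

open MeasureTheory ProbabilityTheory Filter Topology
open scoped ENNReal ComplexConjugate

noncomputable section

/-! ### Homogeneous trees, their boundary and the height functions -/

/-- The homogeneous tree of degree `q + 1`, with `q ≥ 2`: a connected graph without circuits in
which every vertex has exactly `q + 1` neighbours. -/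
structure IsHomogeneousTree {V : Type*} (G : SimpleGraph V) [G.LocallyFinite] (q : ℕ) : Prop where
  two_le : 2 ≤ q
  isTree : G.IsTree
  regular : G.IsRegularOfDegree (q + 1)

/-- The boundary `Ω` of the tree: the infinite geodesic rays starting at the reference point
`o`. -/
@[ext]
structure Boundary {V : Type*} (G : SimpleGraph V) (o : V) where
  ray : ℕ → V
  ray_zero : ray 0 = o
  dist_ray : ∀ m k : ℕ, G.dist (ray m) (ray (m + k)) = k

section Trees

variable {V : Type*} {G : SimpleGraph V}

/-- `E(x)`: the set of the rays from `o` that pass through the vertex `x`. -/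
def cylinderSet (G : SimpleGraph V) (o x : V) : Set (Boundary G o) :=
  {ω | x ∈ Set.range ω.ray}

/-- The `σ`-algebra on the boundary generated by the sets `E(x)`. -/
instance boundaryMeasurableSpace (o : V) : MeasurableSpace (Boundary G o) :=
  MeasurableSpace.generateFrom (Set.range (cylinderSet G o))

/-- The height function `h_ω(x) = lim_{m → ∞} (m - d(x, ω_m))`. -/
def height {o : V} (ω : Boundary G o) (x : V) : ℤ :=
  limUnder atTop fun m : ℕ => (m : ℤ) - (G.dist x (ω.ray m) : ℤ)

/-- The limit that defines the height function exists. -/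
theorem tendsto_height (hG : G.Connected) {o : V} (ω : Boundary G o) (x : V) :
    Tendsto (fun m : ℕ => (m : ℤ) - (G.dist x (ω.ray m) : ℤ)) atTop (𝓝 (height ω x)) := by
  set f : ℕ → ℤ := fun m => (m : ℤ) - (G.dist x (ω.ray m) : ℤ) with hf
  have hmono : Monotone f := by
    refine monotone_nat_of_le_succ fun m => ?_
    have h1 := hG.dist_triangle (u := x) (v := ω.ray m) (w := ω.ray (m + 1))
    rw [ω.dist_ray m 1] at h1
    simp only [hf]; push_cast; omega
  have hbd : ∀ m, f m ≤ (G.dist o x : ℤ) := by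
    intro m
    have h1 := hG.dist_triangle (u := o) (v := x) (w := ω.ray m)
    have h2 := ω.dist_ray 0 m
    rw [ω.ray_zero, Nat.zero_add] at h2
    simp only [hf]; omega
  have : Tendsto f atTop (𝓝 (⨆ m, f m)) :=
    tendsto_atTop_ciSup hmono ⟨_, by rintro _ ⟨m, rfl⟩; exact hbd m⟩
  exact tendsto_nhds_limUnder ⟨_, this⟩

/-! ### The invariant probability measure on the boundary -/

/-- The successors of `x`: the neighbours of `x` that are farther from `o` than `x`. -/
@[ext]
structure TreeSucc (G : SimpleGraph V) (o x : V) where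
  vertex : V
  adj : G.Adj x vertex
  dist_eq : G.dist o vertex = G.dist o x + 1

instance (o x : V) : MeasurableSpace (TreeSucc G o x) := ⊤

/-- The sequence that starts at `o` and moves at every vertex to the chosen successor. -/
def pathOfChoice {o : V} (c : ∀ x, TreeSucc G o x) : ℕ → V
  | 0 => o
  | n + 1 => (c (pathOfChoice c n)).vertex

theorem dist_pathOfChoice {o : V} (c : ∀ x, TreeSucc G o x) (n : ℕ) :
    G.dist o (pathOfChoice c n) = n := by
  induction n with
  | zero => simp [pathOfChoice]
  | succ n ih => rw [pathOfChoice, (c (pathOfChoice c n)).dist_eq, ih]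

theorem dist_pathOfChoice_add (hG : G.Connected) {o : V} (c : ∀ x, TreeSucc G o x) (m k : ℕ) :
    G.dist (pathOfChoice c m) (pathOfChoice c (m + k)) = k := by
  apply le_antisymm
  · induction k with
    | zero => simp
    | succ k ih =>
      have h1 := hG.dist_triangle (u := pathOfChoice c m) (v := pathOfChoice c (m + k))
        (w := pathOfChoice c (m + (k + 1)))
      have h2 : G.dist (pathOfChoice c (m + k)) (pathOfChoice c (m + (k + 1))) = 1 :=
        SimpleGraph.dist_eq_one_iff_adj.2 (c (pathOfChoice c (m + k))).adj
      omega
  · have h1 := hG.dist_triangle (u := o) (v := pathOfChoice c m) (w := pathOfChoice c (m + k))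
    rw [dist_pathOfChoice, dist_pathOfChoice] at h1
    omega

/-- The ray from `o` that moves at every vertex to the chosen successor. -/
def rayOfChoice (hG : G.Connected) {o : V} (c : ∀ x, TreeSucc G o x) : Boundary G o where
  ray := pathOfChoice c
  ray_zero := rfl
  dist_ray := dist_pathOfChoice_add hG c

/-- The probability measure `ν` on the boundary that is invariant under the automorphisms fixing
`o`: the law of the random ray from `o` which moves, at every vertex independently, to a uniformly
chosen successor.  Its values on the generating sets, which determine it, are computed in
`boundaryMeasure_cylinderSet`. -/
def boundaryMeasure [G.LocallyFinite] {q : ℕ} (hX : IsHomogeneousTree G q) (o : V) : Measure (Boundary G o) :=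
  (Measure.infinitePi fun x : V => uniformOn (Set.univ : Set (TreeSucc G o x))).map
    (rayOfChoice hX.isTree.connected)

theorem parent_unique (hG : G.IsTree) {o x y z : V} (hy : G.Adj y x) (hz : G.Adj z x)
    (dy : G.dist o x = G.dist o y + 1) (dz : G.dist o x = G.dist o z + 1) : y = z := by
  obtain ⟨p, hp⟩ := hG.connected.exists_walk_length_eq_dist o y
  obtain ⟨r, hr⟩ := hG.connected.exists_walk_length_eq_dist o z
  have h1 : (p.concat hy).IsPath :=
    SimpleGraph.Walk.isPath_of_length_eq_dist _ (by simp [hp, dy])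
  have h2 : (r.concat hz).IsPath :=
    SimpleGraph.Walk.isPath_of_length_eq_dist _ (by simp [hr, dz])
  have h3 := (hG.existsUnique_path o x).unique h1 h2
  have := congrArg SimpleGraph.Walk.penultimate h3
  simpa using this

theorem exists_parent (hG : G.IsTree) {o x : V} (hx : x ≠ o) :
    ∃ y, G.Adj y x ∧ G.dist o x = G.dist o y + 1 := by
  obtain ⟨p, hp⟩ := hG.connected.exists_walk_length_eq_dist x o
  cases p with
  | nil => exact absurd rfl hx
  | cons h r =>
    rename_i y
    refine ⟨y, h.symm, ?_⟩
    have h1 := SimpleGraph.dist_le r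
    have h2 := hG.connected.dist_triangle (u := x) (v := y) (w := o)
    rw [SimpleGraph.dist_eq_one_iff_adj.2 h] at h2
    rw [SimpleGraph.Walk.length_cons] at hp
    rw [SimpleGraph.dist_comm (u := o) (v := x), SimpleGraph.dist_comm (u := o) (v := y)]
    omega

theorem rayOfChoice_preimage (hG : G.Connected) {o : V} (x : V) :
    rayOfChoice hG ⁻¹' cylinderSet G o x =
      {c : ∀ x, TreeSucc G o x | pathOfChoice c (G.dist o x) = x} := by
  ext c
  constructor
  · rintro ⟨n, hn⟩
    have hn' : pathOfChoice c n = x := hn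
    have : G.dist o x = n := by rw [← hn', dist_pathOfChoice]
    rw [Set.mem_ofPred_eq, this, hn']
  · intro h
    exact ⟨_, h⟩

variable [G.LocallyFinite] {q : ℕ}

theorem ncard_succ (hX : IsHomogeneousTree G q) (o x : V) [Decidable (x = o)] :
    {y : V | G.Adj x y ∧ G.dist o y = G.dist o x + 1}.ncard = if x = o then q + 1 else q := by
  have hreg : (G.neighborSet x).ncard = q + 1 := by
    rw [← hX.regular x, ← SimpleGraph.card_neighborSet_eq_degree, ← Nat.card_eq_fintype_card]
    rfl
  split_ifs with h
  · subst h
    rw [← hreg]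
    congr 1
    ext y
    simp only [Set.mem_ofPred_eq, SimpleGraph.mem_neighborSet, SimpleGraph.dist_self, zero_add,
      and_iff_left_iff_imp]
    exact fun h => SimpleGraph.dist_eq_one_iff_adj.2 h
  · obtain ⟨p, hp, dp⟩ := exists_parent hX.isTree h
    have : {y : V | G.Adj x y ∧ G.dist o y = G.dist o x + 1} = G.neighborSet x \ {p} := by
      ext y
      simp only [Set.mem_ofPred_eq, Set.mem_sdiff, SimpleGraph.mem_neighborSet,
        Set.mem_singleton_iff]
      constructor
      · rintro ⟨h1, h2⟩
        refine ⟨h1, ?_⟩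
        rintro rfl
        omega
      · rintro ⟨h1, h2⟩
        refine ⟨h1, ?_⟩
        rcases hX.isTree.dist_eq_dist_add_one_of_adj o h1 with h3 | h3
        · exact absurd (parent_unique hX.isTree h1.symm hp h3 dp) h2
        · exact h3
    have hmem : p ∈ G.neighborSet x := hp.symm
    rw [this, Set.ncard_sdiff_singleton_of_mem hmem, hreg]
    rfl

theorem nat_card_succ (hX : IsHomogeneousTree G q) (o x : V) [Decidable (x = o)] :
    Nat.card (TreeSucc G o x) = if x = o then q + 1 else q :=
  (Nat.card_congr ⟨fun y => ⟨y.vertex, y.adj, y.dist_eq⟩, fun y => ⟨y.1, y.2.1, y.2.2⟩,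
    fun _ => rfl, fun _ => rfl⟩).trans (ncard_succ hX o x)

theorem finite_succ (hX : IsHomogeneousTree G q) (o x : V) : Finite (TreeSucc G o x) := by
  classical
  have := hX.two_le
  refine Nat.finite_of_card_ne_zero ?_
  rw [nat_card_succ hX]
  split_ifs <;> omega

theorem nonempty_succ (hX : IsHomogeneousTree G q) (o x : V) : Nonempty (TreeSucc G o x) := by
  classical
  have := hX.two_le
  by_contra h
  rw [not_nonempty_iff] at h
  have := nat_card_succ hX o x
  rw [Nat.card_of_isEmpty] at this
  split_ifs at this <;> omega

theorem isProbabilityMeasure_uniformOn_succ (hX : IsHomogeneousTree G q) (o x : V) :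
    IsProbabilityMeasure (uniformOn (Set.univ : Set (TreeSucc G o x))) := by
  have := finite_succ hX o x
  have := nonempty_succ hX o x
  exact isProbabilityMeasure_uniformOn Set.finite_univ Set.univ_nonempty

theorem uniformOn_succ_singleton (hX : IsHomogeneousTree G q) (o x : V) [Decidable (x = o)]
    (y : TreeSucc G o x) :
    uniformOn (Set.univ : Set (TreeSucc G o x)) {y} = ((if x = o then q + 1 else q : ℕ) : ℝ≥0∞)⁻¹ := by
  have := finite_succ hX o x
  have := Fintype.ofFinite (TreeSucc G o x)
  have : MeasurableSingletonClass (TreeSucc G o x) := ⟨fun _ => trivial⟩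
  rw [uniformOn_univ, Measure.count_singleton, ← Nat.card_eq_fintype_card, nat_card_succ hX,
    one_div]

theorem exists_pi_pathOfChoice (hX : IsHomogeneousTree G q) {o : V} (n : ℕ) :
    ∀ x : V, G.dist o x = n → ∃ (s : Finset V) (t : ∀ v, Set (TreeSucc G o v)),
      (∀ v ∈ s, G.dist o v < n) ∧ {c | pathOfChoice c n = x} = (s : Set V).pi t ∧
      ∏ v ∈ s, uniformOn Set.univ (t v) =
        if n = 0 then 1 else (((q + 1) * q ^ (n - 1) : ℕ) : ℝ≥0∞)⁻¹ := by
  classical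
  induction n with
  | zero =>
    intro x hx
    have : o = x := (hX.isTree.connected.dist_eq_zero_iff).1 hx
    refine ⟨∅, fun _ => Set.univ, by simp, ?_, by simp⟩
    ext c
    simp [pathOfChoice, this]
  | succ n ih =>
    intro x hx
    have hxo : x ≠ o := by rintro rfl; simp at hx
    obtain ⟨p, hp, dp⟩ := exists_parent hX.isTree hxo
    have hpn : G.dist o p = n := by omega
    obtain ⟨s, t, hs, hst, hprod⟩ := ih p hpn
    have hps : p ∉ s := fun h => by have := hs p h; omega
    let y : TreeSucc G o p := ⟨x, hp, dp⟩
    refine ⟨insert p s, Function.update t p {y}, ?_, ?_, ?_⟩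
    · intro v hv
      rcases Finset.mem_insert.1 hv with rfl | hv
      · omega
      · have := hs v hv; omega
    · ext c
      have hset : pathOfChoice c n = p ↔ c ∈ (s : Set V).pi t := by
        rw [← hst]; rfl
      have hmem : c ∈ ((insert p s : Finset V) : Set V).pi (Function.update t p {y}) ↔
          c p = y ∧ c ∈ (s : Set V).pi t := by
        simp only [Finset.coe_insert, Set.mem_pi, Set.mem_insert_iff, forall_eq_or_imp,
          Function.update_self, Set.mem_singleton_iff, Finset.mem_coe]
        refine and_congr_right fun _ => forall₂_congr fun v hv => ?_
        have : v ≠ p := by rintro rfl; exact hps hv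
        rw [Function.update_of_ne this]
      rw [hmem, ← hset]
      simp only [Set.mem_ofPred_eq]
      constructor
      · intro h
        have h1 : pathOfChoice c n = p := by
          refine parent_unique hX.isTree (o := o) (x := x) ?_ hp ?_ dp
          · rw [← h]; exact (c (pathOfChoice c n)).adj
          · rw [hx, dist_pathOfChoice]
        refine ⟨?_, h1⟩
        apply TreeSucc.ext
        change (c p).vertex = x
        rw [← h, pathOfChoice, h1]
      · rintro ⟨h1, h2⟩
        rw [pathOfChoice, h2, h1]
    · rw [Finset.prod_insert hps, Function.update_self, uniformOn_succ_singleton hX]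
      have : ∏ v ∈ s, uniformOn Set.univ (Function.update t p {y} v) =
          ∏ v ∈ s, uniformOn Set.univ (t v) := by
        refine Finset.prod_congr rfl fun v hv => ?_
        have : v ≠ p := by rintro rfl; exact hps hv
        rw [Function.update_of_ne this]
      rw [this, hprod]
      rcases Nat.eq_zero_or_pos n with h0 | h0
      · subst h0
        have : p = o := ((hX.isTree.connected.dist_eq_zero_iff).1 hpn).symm
        simp [this]
      · have : p ≠ o := by rintro rfl; simp at hpn; omega
        rw [if_neg this, if_neg h0.ne', if_neg (Nat.succ_ne_zero n),
          ← ENNReal.mul_inv (Or.inr (ENNReal.natCast_ne_top _)) (Or.inl (ENNReal.natCast_ne_top _))]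
        congr 1
        obtain ⟨m, rfl⟩ := Nat.exists_eq_succ_of_ne_zero h0.ne'
        simp only [Nat.succ_eq_add_one, Nat.add_sub_cancel]
        push_cast
        ring

theorem measurable_rayOfChoice (hX : IsHomogeneousTree G q) (o : V) :
    Measurable (rayOfChoice (o := o) hX.isTree.connected) := by
  refine measurable_generateFrom ?_
  rintro _ ⟨x, rfl⟩
  rw [rayOfChoice_preimage]
  obtain ⟨s, t, -, h, -⟩ := exists_pi_pathOfChoice hX (G.dist o x) x rfl
  rw [h]
  exact MeasurableSet.pi s.countable_toSet fun _ _ => MeasurableSpace.measurableSet_top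

instance (hX : IsHomogeneousTree G q) (o : V) : IsProbabilityMeasure (boundaryMeasure hX o) := by
  have := isProbabilityMeasure_uniformOn_succ hX o
  exact Measure.isProbabilityMeasure_map (measurable_rayOfChoice hX o).aemeasurable

/-- `ν(E(x)) = q / ((q + 1) q ^ |x|)` for `x ≠ o`. -/
theorem boundaryMeasure_cylinderSet (hX : IsHomogeneousTree G q) {o x : V} (hx : x ≠ o) :
    boundaryMeasure hX o (cylinderSet G o x) =
      (q : ℝ≥0∞) / (((q : ℝ≥0∞) + 1) * (q : ℝ≥0∞) ^ G.dist o x) := by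
  have := isProbabilityMeasure_uniformOn_succ hX o
  have hq := hX.two_le
  rw [boundaryMeasure, Measure.map_apply (measurable_rayOfChoice hX o)
    (MeasurableSpace.measurableSet_generateFrom ⟨x, rfl⟩), rayOfChoice_preimage]
  obtain ⟨s, t, -, h, hprod⟩ := exists_pi_pathOfChoice hX (G.dist o x) x rfl
  have e0 : Measure.infinitePi (fun x : V => uniformOn (Set.univ : Set (TreeSucc G o x)))
      ((s : Set V).pi t) = ∏ v ∈ s, uniformOn Set.univ (t v) :=
    Measure.infinitePi_pi (fun x : V => uniformOn (Set.univ : Set (TreeSucc G o x)))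
      (fun _ _ => MeasurableSpace.measurableSet_top)
  rw [h, e0, hprod]
  have h0 : G.dist o x ≠ 0 := fun h =>
    hx ((hX.isTree.connected.dist_eq_zero_iff).1 h).symm
  obtain ⟨m, hm⟩ := Nat.exists_eq_succ_of_ne_zero h0
  rw [if_neg h0, hm]
  have hq0 : (q : ℝ≥0∞) ≠ 0 := by simp; omega
  have hqt : (q : ℝ≥0∞) ≠ ∞ := ENNReal.natCast_ne_top q
  have e : ((q : ℝ≥0∞) + 1) * (q : ℝ≥0∞) ^ (m + 1) =
      q * (((q : ℝ≥0∞) + 1) * (q : ℝ≥0∞) ^ m) := by ring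
  simp only [Nat.succ_eq_add_one, Nat.add_sub_cancel]
  rw [e, ENNReal.div_eq_inv_mul, ENNReal.mul_inv (Or.inl hq0) (Or.inl hqt), mul_right_comm,
    ENNReal.inv_mul_cancel hq0 hqt, one_mul]
  push_cast
  rfl

end Trees

/-! ### The Fourier–Helgason transform and pseudo-differential operators -/

/-- `τ = π / log q`. -/
def tau (q : ℕ) : ℝ := Real.pi / Real.log q

/-- The function
`c(z) = q^{1/2} / (q + 1) * (q^{1/2 + iz} - q^{-1/2 - iz}) / (q^{iz} - q^{-iz})`. -/
def cFunction (q : ℕ) (z : ℂ) : ℂ :=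
  (q : ℂ) ^ (1 / 2 : ℂ) / ((q : ℂ) + 1) *
    (((q : ℂ) ^ (1 / 2 + Complex.I * z) - (q : ℂ) ^ (-(1 / 2) - Complex.I * z)) /
      ((q : ℂ) ^ (Complex.I * z) - (q : ℂ) ^ (-(Complex.I * z))))

/-- The constant `c_P = q log q / (2 π (q + 1))`, which makes the Plancherel measure a probability
measure on `[0, τ]`, as the inversion and Plancherel formulas over `[0, τ]` require. -/
def plancherelConst (q : ℕ) : ℝ :=
  (q : ℝ) * Real.log q / (2 * Real.pi * ((q : ℝ) + 1))

/-- The Plancherel measure `dμ(s) = c_P |c(s)|^{-2} ds` on `[0, τ]`; the points `0` and `τ`, where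
`c` has its poles, are null sets. -/
def plancherelMeasure (q : ℕ) : Measure (Set.Icc (0 : ℝ) (tau q)) :=
  ((volume : Measure ℝ).comap Subtype.val).withDensity fun s =>
    ENNReal.ofReal (plancherelConst q * (‖cFunction q ((s : ℝ) : ℂ)‖ ^ 2)⁻¹)

section Operators

variable {V : Type*} {G : SimpleGraph V} {o : V}

/-- `q^{(1/2 + is) h_ω(x)}`. -/
def wavePlus (q : ℕ) (ω : Boundary G o) (s : ℝ) (x : V) : ℂ :=
  (q : ℂ) ^ ((1 / 2 + Complex.I * (s : ℂ)) * ((height ω x : ℤ) : ℂ))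

/-- `q^{(1/2 - is) h_ω(x)}`. -/
def waveMinus (q : ℕ) (ω : Boundary G o) (s : ℝ) (x : V) : ℂ :=
  (q : ℂ) ^ ((1 / 2 - Complex.I * (s : ℂ)) * ((height ω x : ℤ) : ℂ))

/-- The Fourier–Helgason transform `ℋf(ω, s) = ∑_y f(y) q^{(1/2 + is) h_ω(y)}` of a finitely
supported function. -/
def helgasonTransform (q : ℕ) (f : V →₀ ℂ) (ω : Boundary G o) (s : ℝ) : ℂ :=
  ∑ y ∈ f.support, f y * wavePlus q ω s y

/-- The integrand `q^{(1/2 - is) h_ω(x)} σ(x, ω, s) ℋf(ω, s)` of `T_σ f(x)`. -/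
def pdoIntegrand (q : ℕ) (σ : V × Boundary G o × Set.Icc (0 : ℝ) (tau q) → ℂ) (f : V →₀ ℂ) (x : V)
    (p : Boundary G o × Set.Icc (0 : ℝ) (tau q)) : ℂ :=
  waveMinus q p.1 p.2 x * σ (x, p) * helgasonTransform q f p.1 p.2

/-- The pseudo-differential operator with symbol `σ` on finitely supported functions,
`T_σ f(x) = ∫_Ω ∫_0^τ q^{(1/2 - is) h_ω(x)} σ(x, ω, s) ℋf(ω, s) dν(ω) dμ(s)`. -/
def pdo [G.LocallyFinite] {q : ℕ} (hX : IsHomogeneousTree G q)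
    (σ : V × Boundary G o × Set.Icc (0 : ℝ) (tau q) → ℂ) (f : V →₀ ℂ) (x : V) : ℂ :=
  ∫ p, pdoIntegrand q σ f x p ∂((boundaryMeasure hX o).prod (plancherelMeasure q))

/-- The Hilbert space `L²(𝔛)` for the counting measure. -/
abbrev EllTwo (V : Type*) : Type _ := lp (fun _ : V => ℂ) 2

/-- The bounded operator `T` on `L²(𝔛)` is the pseudo-differential operator `T_σ`: the integrals
that define `T_σ f` converge absolutely for every finitely supported `f`, and `T f = T_σ f` for
these `f`. As the finitely supported functions are dense, `T` is the only such operator. -/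
def IsPdo [G.LocallyFinite] {q : ℕ} (hX : IsHomogeneousTree G q)
    (σ : V × Boundary G o × Set.Icc (0 : ℝ) (tau q) → ℂ) (T : EllTwo V →L[ℂ] EllTwo V) : Prop :=
  (∀ (f : V →₀ ℂ) (x : V), Integrable (pdoIntegrand q σ f x)
      ((boundaryMeasure hX o).prod (plancherelMeasure q))) ∧
    ∀ (f : V →₀ ℂ) (g : EllTwo V), (∀ y, g y = f y) → ∀ x, T g x = pdo hX σ f x

/-- The function `b(x, ω, s) = conj (σ(x, ω, s)) q^{(1/2 + is) h_ω(x)}`. -/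
def bSymbol (q : ℕ) (σ : V × Boundary G o × Set.Icc (0 : ℝ) (tau q) → ℂ)
    (p : V × Boundary G o × Set.Icc (0 : ℝ) (tau q)) : ℂ :=
  conj (σ p) * wavePlus q p.2.1 p.2.2 p.1

end Operators

/-! ### Schatten classes -/

section Schatten

variable {H : Type*} [NormedAddCommGroup H] [InnerProductSpace ℂ H] [CompleteSpace H]

/-- The multiplicity of `t` as a singular value of `A`, that is, the dimension of the eigenspace
of `|A| = √(A* A)` for the eigenvalue `t`. -/
def singularMultiplicity (A : H →L[ℂ] H) (t : ℝ) : ℕ∞ :=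
  Cardinal.toENat (Module.rank ℂ
    (Module.End.eigenspace ((CFC.abs A : H →L[ℂ] H) : H →ₗ[ℂ] H) (t : ℂ)))

/-- The sum `∑ s_n(A)^r` over the nonzero singular values of `A`, counted with multiplicity. -/
def schattenSum (r : ℝ) (A : H →L[ℂ] H) : ℝ≥0∞ :=
  ∑' t : Set.Ioi (0 : ℝ), (singularMultiplicity A t : ℝ≥0∞) * ENNReal.ofReal (t : ℝ) ^ r

/-- The Schatten class `S_r(H)`: the compact operators with `∑ s_n(A)^r < ∞`. -/
def IsSchatten (r : ℝ) (A : H →L[ℂ] H) : Prop :=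
  IsCompactOperator A ∧ schattenSum r A < ∞

/-- The norm `‖A‖_{S_r} = (∑ s_n(A)^r)^{1/r}` of `A ∈ S_r(H)`. -/
def schattenNorm (r : ℝ) (A : H →L[ℂ] H) : ℝ≥0∞ := schattenSum r A ^ (1 / r)

/-- Hilbert–Schmidt operators are the elements of `S_2(H)`. -/
def IsHilbertSchmidt (A : H →L[ℂ] H) : Prop := IsSchatten 2 A

end Schatten

end

/-!
Write `W_y(ω, s) = q^{(1/2 + is) h_ω(y)}` for the plane waves. The matrix entry of `T_σ` at `(x, y)`
is `∫ conj b(x, ·) W_y`, so everything reduces to two facts.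

*The plane waves form an orthonormal basis of `L²(Ω × [0, τ])`, and they determine integrable
functions.* With `z = q^{1/2 + is}` and `p` the parent of `y`, the height drops by one along the
edge from `p` to `y` except on the cylinder `E(y)`, whence
`W_y = z⁻¹ W_p + (1 - z⁻²) z^{|y|} 1_{E(y)}` (`wavePlus_eq_add_indicator`). Integrating this
against `W_x`, which is constant on `E(y)` if `|x| ≤ |y|`, shows by induction that
`∫ W_x conj W_y dν` is the spherical function at `d(x, y)` (`integral_wavePlus_mul_conj`). Its
integrals against the Plancherel measure are bounded and satisfy a recurrence in the distance under
which a nonzero value at a positive distance would grow geometrically (`sphericalMoment_eq`).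

For completeness, let `F` be integrable and orthogonal to all `W_y`. Since
`∑_{y ~ x} W_y = λ W_x` with `λ(s) = 2 √q cos (s log q)`, the function
`s ↦ ∫ F W_x dν` is orthogonal to all powers of `λ`, which is injective on `[0, τ]`; by the Stone–Weierstrass theorem it vanishes. The relation between `W_y` and `W_p` then gives
`∫_{E(y)} F dν = 0` for every `y`, and `F = 0`
(`ae_eq_zero_of_forall_integral_mul_wavePlus`). Completeness for integrable rather than square
integrable functions is what allows the conclusion `b(x, ·) ∈ L²` from the mere absolute convergence
of the integrals defining `T_σ`: Parseval's identity holds in `[0, ∞]` for all integrable functions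
(`lintegral_enorm_sq_eq_tsum`).

*For a compact operator, `∑ s_n(A)²` is the sum of `‖A e‖²` over any orthonormal basis, and
finiteness of the latter sum implies compactness* (`schattenSum_two_eq_tsum`,
`isCompactOperator_of_tsum_enorm_sq_ne_top`). The first statement is the spectral theorem for `|A|`
together with the independence of the sum of the basis, the second is approximation by finite
rank operators.

Summing Parseval's identity for `conj b(x, ·)` over `x` identifies `‖b‖²` with `∑_y ‖T_σ δ_y‖²`.
-/

noncomputable section

/-! ### Hilbert–Schmidt operators -/

section HilbertSchmidt

variable {H : Type*} [NormedAddCommGroup H] [InnerProductSpace ℂ H]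
variable {ι κ : Type*}

theorem HilbertBasis.enorm_sq_eq_tsum (f : HilbertBasis κ ℂ H) (v : H) :
    ‖v‖ₑ ^ 2 = ∑' j, ‖inner ℂ (f j) v‖ₑ ^ 2 := by
  have h1 : HasSum (fun j => ‖inner ℂ (f j) v‖ ^ 2) (‖v‖ ^ 2) := by
    have h := (f.hasSum_inner_mul_inner v v).mapL Complex.reCLM
    simp only [Complex.reCLM_apply] at h
    have h2 : (inner ℂ v v).re = ‖v‖ ^ 2 := by
      rw [inner_self_eq_norm_sq_to_K]; norm_cast
    rw [h2] at h
    refine h.congr_fun fun j => ?_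
    rw [← inner_conj_symm v (f j), Complex.conj_mul']; norm_cast
  have h3 := ENNReal.ofReal_tsum_of_nonneg (fun j => sq_nonneg ‖inner ℂ (f j) v‖) h1.summable
  rw [h1.tsum_eq] at h3
  simpa only [ENNReal.ofReal_pow (norm_nonneg _), ofReal_norm] using h3

theorem isClosed_eigenspace (P : H →L[ℂ] H) (z : ℂ) :
    IsClosed (Module.End.eigenspace (P : H →ₗ[ℂ] H) z : Set H) := by
  have : (Module.End.eigenspace (P : H →ₗ[ℂ] H) z : Set H) = {x | P x = z • x} := by
    ext x; simp
  rw [this]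
  exact isClosed_eq P.continuous (continuous_const_smul z)

/-- Operators with values in `ℓ²` can be prescribed by square summable rows. -/
theorem exists_clm_of_summable_rows (r : κ → H) (h : Summable fun x => ‖r x‖ ^ 2) :
    ∃ T : H →L[ℂ] EllTwo κ, ∀ f x, T f x = inner ℂ (r x) f := by
  have hle : ∀ f x, ‖inner ℂ (r x) f‖ ^ 2 ≤ ‖r x‖ ^ 2 * ‖f‖ ^ 2 := fun f x => by
    rw [← mul_pow]
    exact pow_le_pow_left₀ (norm_nonneg _) (norm_inner_le_norm _ _) 2
  have hs : ∀ f, Summable fun x => ‖inner ℂ (r x) f‖ ^ 2 := fun f =>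
    Summable.of_nonneg_of_le (fun _ => sq_nonneg _) (hle f) (h.mul_right _)
  have hm : ∀ f, Memℓp (fun x => inner ℂ (r x) f) 2 := fun f =>
    memℓp_gen (by simpa using hs f)
  let L : H →ₗ[ℂ] EllTwo κ :=
    { toFun := fun f => ⟨fun x => inner ℂ (r x) f, hm f⟩
      map_add' := fun f g => by ext x; exact inner_add_right _ _ _
      map_smul' := fun c f => by ext x; exact inner_smul_right _ _ _ }
  refine ⟨L.mkContinuous √(∑' x, ‖r x‖ ^ 2) fun f => ?_, fun f x => rfl⟩
  refine le_of_sq_le_sq ?_ (by positivity)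
  rw [mul_pow, Real.sq_sqrt (tsum_nonneg fun _ => sq_nonneg _), ← tsum_mul_right]
  have h1 := lp.norm_rpow_eq_tsum (p := 2) (by simp) (L f)
  simp only [ENNReal.toReal_ofNat, Real.rpow_ofNat] at h1
  rw [h1]
  exact (hs f).tsum_le_tsum (hle f) (h.mul_right _)

variable [CompleteSpace H]

/-- The sum of `‖A e‖²` over an orthonormal basis agrees with the corresponding sum for the adjoint
over any other orthonormal basis; in particular it does not depend on the basis. -/
theorem HilbertBasis.tsum_enorm_sq_adjoint (e : HilbertBasis ι ℂ H) (f : HilbertBasis κ ℂ H)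
    (A : H →L[ℂ] H) :
    ∑' i, ‖A (e i)‖ₑ ^ 2 = ∑' j, ‖ContinuousLinearMap.adjoint A (f j)‖ₑ ^ 2 := by
  simp_rw [f.enorm_sq_eq_tsum (A (e _)), e.enorm_sq_eq_tsum (ContinuousLinearMap.adjoint A _)]
  rw [ENNReal.tsum_comm]
  refine tsum_congr fun j => tsum_congr fun i => ?_
  rw [ContinuousLinearMap.adjoint_inner_right, ← inner_conj_symm, RCLike.enorm_conj]

theorem HilbertBasis.tsum_enorm_sq_eq (e : HilbertBasis ι ℂ H) (f : HilbertBasis κ ℂ H)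
    (A : H →L[ℂ] H) : ∑' i, ‖A (e i)‖ₑ ^ 2 = ∑' j, ‖A (f j)‖ₑ ^ 2 :=
  (e.tsum_enorm_sq_adjoint e A).trans (f.tsum_enorm_sq_adjoint e A).symm

theorem isSymmetric_cfcAbs (A : H →L[ℂ] H) : (CFC.abs A : H →L[ℂ] H).IsSymmetric :=
  (ContinuousLinearMap.isSelfAdjoint_iff_isSymmetric).1 (CFC.abs_nonneg A).isSelfAdjoint

theorem inner_cfcAbs_apply (A : H →L[ℂ] H) (x y : H) :
    inner ℂ ((CFC.abs A : H →L[ℂ] H) x) ((CFC.abs A : H →L[ℂ] H) y) = inner ℂ (A x) (A y) := by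
  have h := isSymmetric_cfcAbs A x ((CFC.abs A : H →L[ℂ] H) y)
  refine h.trans ?_
  change inner ℂ x ((CFC.abs A * CFC.abs A : H →L[ℂ] H) y) = _
  rw [CFC.abs_mul_abs]
  exact ContinuousLinearMap.adjoint_inner_right A x (A y)

theorem norm_cfcAbs_apply (A : H →L[ℂ] H) (x : H) :
    ‖(CFC.abs A : H →L[ℂ] H) x‖ = ‖A x‖ := by
  rw [@norm_eq_sqrt_re_inner ℂ, @norm_eq_sqrt_re_inner ℂ, inner_cfcAbs_apply]

/-- `|A|` is compact since `‖|A| x‖ = ‖A x‖`: approximations of the image of the unit ball under `A`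
by finite sets carry over to `|A|`. -/
theorem isCompactOperator_cfcAbs {A : H →L[ℂ] H} (hA : IsCompactOperator A) :
    IsCompactOperator (CFC.abs A : H →L[ℂ] H) := by
  set P : H →L[ℂ] H := CFC.abs A
  refine (isCompactOperator_iff_isCompact_closure_image_ball (P : H →ₗ[ℂ] H) (r := 1) one_pos).2 ?_
  refine TotallyBounded.isCompact_of_isClosed (TotallyBounded.closure ?_) isClosed_closure
  have hT : TotallyBounded (A '' Metric.ball 0 1) :=
    ((IsCompactOperator.isCompact_closure_image_ball (f := (A : H →ₗ[ℂ] H)) hA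
      1).totallyBounded).subset subset_closure
  refine Metric.totallyBounded_iff.2 fun ε hε => ?_
  obtain ⟨t, hts, htf, ht⟩ := Metric.finite_approx_of_totallyBounded hT ε hε
  choose! g hg using fun y (hy : y ∈ t) => hts hy
  refine ⟨(fun y => P (g y)) '' t, htf.image _, ?_⟩
  rintro _ ⟨x, hx, rfl⟩
  obtain ⟨y, hy, hxy⟩ := Set.mem_iUnion₂.1 (ht ⟨x, hx, rfl⟩)
  refine Set.mem_iUnion₂.2 ⟨P (g y), ⟨y, hy, rfl⟩, ?_⟩
  have h1 : ‖P (x - g y)‖ < ε := by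
    rw [norm_cfcAbs_apply, map_sub, (hg y hy).2, ← dist_eq_norm]
    exact hxy
  rw [map_sub, ← dist_eq_norm] at h1
  exact h1

/-- The eigenvalues of `|A|` are nonnegative reals. -/
theorem nonneg_of_hasEigenvalue_cfcAbs (A : H →L[ℂ] H) {z : ℂ}
    (hz : Module.End.eigenspace ((CFC.abs A : H →L[ℂ] H) : H →ₗ[ℂ] H) z ≠ ⊥) :
    ∃ t : ℝ, 0 ≤ t ∧ (t : ℂ) = z := by
  obtain ⟨v, hv, hv0⟩ := Submodule.exists_mem_ne_zero_of_ne_bot hz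
  rw [Module.End.mem_eigenspace_iff] at hv
  have h1 : Module.End.HasEigenvalue ((CFC.abs A : H →L[ℂ] H) : H →ₗ[ℂ] H) z := hz
  have h2 := (isSymmetric_cfcAbs A).conj_eigenvalue_eq_self h1
  obtain ⟨t, rfl⟩ := Complex.conj_eq_iff_real.1 h2
  refine ⟨t, ?_, rfl⟩
  refine eigenvalue_nonneg_of_nonneg (𝕜 := ℂ) h1 fun x => ?_
  exact ((ContinuousLinearMap.nonneg_iff_isPositive _).1 (CFC.abs_nonneg A)).re_inner_nonneg_right x

/-- For a compact operator, `∑ s_n(A)²` is the square of the Hilbert–Schmidt norm computed in any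
orthonormal basis. -/
theorem schattenSum_two_eq_tsum {A : H →L[ℂ] H} (hA : IsCompactOperator A)
    (f : HilbertBasis κ ℂ H) : schattenSum 2 A = ∑' j, ‖A (f j)‖ₑ ^ 2 := by
  classical
  set P : H →L[ℂ] H := CFC.abs A with hP
  have hPc : IsCompactOperator P := isCompactOperator_cfcAbs hA
  let E : ℂ → Submodule ℂ H := fun z => Module.End.eigenspace (P : H →ₗ[ℂ] H) z
  have hE : ∀ z, CompleteSpace (E z) := fun z => (isClosed_eigenspace P z).completeSpace_coe
  -- orthonormal bases of the eigenspaces of `|A|`, collected into one basis of the whole space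
  choose w b _ using fun z => exists_hilbertBasis ℂ (E z)
  let v : (Σ z, w z) → H := fun i => (b i.1 i.2 : H)
  have hv : Orthonormal ℂ v :=
    (isSymmetric_cfcAbs A).orthogonalFamily_eigenspaces.orthonormal_sigma_orthonormal
      (fun z => (b z).orthonormal)
  have hsp : (Submodule.span ℂ (Set.range v))ᗮ = ⊥ := by
    rw [eq_bot_iff, ← ContinuousLinearMap.orthogonalComplement_iSup_eigenspaces_eq_bot hPc
      (isSymmetric_cfcAbs A), ← Submodule.iInf_orthogonal, le_iInf_iff]
    intro z x hx y hy
    -- a vector orthogonal to the basis of an eigenspace is orthogonal to the eigenspace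
    have h1 : HasSum (fun i => inner ℂ x (b z i : H) * (b z).repr ⟨y, hy⟩ i) (inner ℂ x y) := by
      have := ((b z).hasSum_repr ⟨y, hy⟩).mapL ((innerSL ℂ x) ∘L (E z).subtypeL)
      refine (this.congr_fun fun i => ?_)
      simp [mul_comm]
    have h2 : ∀ i, inner ℂ x (b z i : H) = 0 := fun i => by
      rw [← inner_conj_symm, hx (b z i : H) (Submodule.subset_span ⟨⟨z, i⟩, rfl⟩), map_zero]
    simp only [h2, zero_mul] at h1
    rw [← inner_conj_symm, h1.unique hasSum_zero, map_zero]
  let e := HilbertBasis.mkOfOrthogonalEqBot hv hsp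
  have he : ∀ i, A (e i) = A (v i) := fun i => by rw [HilbertBasis.coe_mkOfOrthogonalEqBot]
  have hnorm : ∀ i : Σ z, w z, ‖A (v i)‖ₑ = ‖i.1‖ₑ := by
    rintro ⟨z, i⟩
    have h1 : P (b z i : H) = z • (b z i : H) := Module.End.mem_eigenspace_iff.1 (b z i).2
    have h2 : ‖(b z i : H)‖ = 1 := (b z).orthonormal.1 i
    rw [enorm_eq_iff_norm_eq, ← norm_cfcAbs_apply, ← hP]
    change ‖P (b z i : H)‖ = _
    rw [h1, norm_smul, h2, mul_one]
  rw [← e.tsum_enorm_sq_eq f]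
  simp_rw [he, hnorm]
  rw [ENNReal.tsum_sigma']
  simp only [ENNReal.tsum_const, schattenSum]
  -- the nonzero eigenvalues are positive reals, so the sum over `ℂ` reduces to one over `(0, ∞)`
  have hinj : Function.Injective (fun t : Set.Ioi (0 : ℝ) => ((t : ℝ) : ℂ)) :=
    fun s t h => Subtype.ext (Complex.ofReal_injective h)
  rw [← hinj.tsum_eq]
  · refine tsum_congr fun t => ?_
    have ht : ((t : ℝ) : ℂ) ≠ 0 := Complex.ofReal_ne_zero.2 (ne_of_gt t.2)
    congr 1
    · have hfd : FiniteDimensional ℂ (E (t : ℝ)) :=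
        ContinuousLinearMap.finite_dimensional_eigenspace hPc _ ht
      have := (b (t : ℝ)).orthonormal.linearIndependent.finite
      have := Fintype.ofFinite (w (t : ℝ))
      congr 1
      change Cardinal.toENat (Module.rank ℂ (E (t : ℝ))) = _
      rw [rank_eq_card_basis (b (t : ℝ)).toOrthonormalBasis.toBasis,
        ENat.card_eq_coe_fintype_card, map_natCast]
    · rw [← ofReal_norm, Complex.norm_of_nonneg t.2.le]
      norm_cast
  · intro z hz
    have hz' : z ≠ 0 ∧ Nonempty (w z) := by
      constructor
      · rintro rfl; simp at hz
      · by_contra h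
        rw [not_nonempty_iff, Set.isEmpty_coe_sort] at h
        simp [h] at hz
    obtain ⟨hz0, ⟨i⟩⟩ := hz'
    obtain ⟨t, ht, rfl⟩ := nonneg_of_hasEigenvalue_cfcAbs A (z := z) (by
      intro h
      have h1 : (b z i : H) ∈ (⊥ : Submodule ℂ H) := h ▸ (b z i).2
      have h2 : ‖(b z i : H)‖ = 1 := (b z).orthonormal.1 i
      rw [(Submodule.mem_bot ℂ).1 h1] at h2
      simp at h2)
    exact ⟨⟨t, lt_of_le_of_ne ht (by rintro rfl; simp at hz0)⟩, rfl⟩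

/-- The operator norm is at most the Hilbert–Schmidt norm. -/
theorem HilbertBasis.enorm_sq_le_tsum (f : HilbertBasis κ ℂ H) (B : H →L[ℂ] H) :
    ‖B‖ₑ ^ 2 ≤ ∑' j, ‖B (f j)‖ₑ ^ 2 := by
  rcases eq_or_ne (∑' j, ‖B (f j)‖ₑ ^ 2) ∞ with h | h
  · rw [h]; exact le_top
  have key : ∀ x, ‖B x‖ₑ ^ 2 ≤ (∑' j, ‖B (f j)‖ₑ ^ 2) * ‖x‖ₑ ^ 2 := by
    intro x
    rw [f.enorm_sq_eq_tsum, f.tsum_enorm_sq_adjoint f, ← ENNReal.tsum_mul_right]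
    refine ENNReal.tsum_le_tsum fun j => ?_
    rw [← ContinuousLinearMap.adjoint_inner_left, ← mul_pow]
    gcongr
    rw [← ofReal_norm, ← ofReal_norm, ← ofReal_norm, ← ENNReal.ofReal_mul (norm_nonneg _)]
    exact ENNReal.ofReal_le_ofReal (norm_inner_le_norm _ _)
  set S := ∑' j, ‖B (f j)‖ₑ ^ 2
  have h1 : ‖B‖ ≤ √S.toReal := by
    refine B.opNorm_le_bound (Real.sqrt_nonneg _) fun x => ?_
    refine le_of_sq_le_sq ?_ (by positivity)
    rw [mul_pow, Real.sq_sqrt ENNReal.toReal_nonneg]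
    have := ENNReal.toReal_mono (ENNReal.mul_ne_top h (by simp)) (key x)
    simpa using this
  rw [← ENNReal.ofReal_toReal h, ← ofReal_norm, ← ENNReal.ofReal_pow (norm_nonneg _)]
  refine ENNReal.ofReal_le_ofReal ?_
  calc ‖B‖ ^ 2 ≤ √S.toReal ^ 2 := by gcongr
    _ = _ := Real.sq_sqrt ENNReal.toReal_nonneg

/-- An operator with finite Hilbert–Schmidt norm is compact, being a limit of its finite rank
truncations. -/
theorem isCompactOperator_of_tsum_enorm_sq_ne_top (f : HilbertBasis κ ℂ H) (A : H →L[ℂ] H)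
    (h : ∑' j, ‖A (f j)‖ₑ ^ 2 ≠ ∞) : IsCompactOperator A := by
  classical
  let R : Finset κ → H →L[ℂ] H := fun s =>
    ∑ j ∈ s, (innerSL ℂ (f j)).smulRight (A (f j))
  have hR : ∀ s, IsCompactOperator (R s) := by
    intro s
    change R s ∈ compactOperator (RingHom.id ℂ) H H
    refine Submodule.sum_mem _ fun j _ => ?_
    change IsCompactOperator ((innerSL ℂ (f j)).smulRight (A (f j)))
    have h1 : IsCompactOperator (ContinuousLinearMap.toSpanSingleton ℂ (A (f j))) :=
      isCompactOperator_of_locallyCompactSpace_rng _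
    exact h1.comp_clm (innerSL ℂ (f j))
  refine isCompactOperator_of_tendsto (l := atTop) (F := R) ?_ (Eventually.of_forall hR)
  have hval : ∀ s j, (R s - A) (f j) = if j ∈ s then 0 else - A (f j) := by
    intro s j
    simp only [R, sub_apply, sum_apply,
      ContinuousLinearMap.smulRight_apply, innerSL_apply_apply,
      orthonormal_iff_ite.1 f.orthonormal, ite_smul, one_smul, zero_smul, Finset.sum_ite_eq']
    split_ifs <;> simp
  have hle : ∀ s : Finset κ, ‖R s - A‖ₑ ^ 2 ≤ ∑' j : {j // j ∉ s}, ‖A (f j)‖ₑ ^ 2 := by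
    intro s
    refine (f.enorm_sq_le_tsum _).trans (le_of_eq ?_)
    simp_rw [hval]
    rw [← tsum_subtype_eq_of_support_subset (s := {j | j ∉ s})]
    · exact tsum_congr fun j => by rw [if_neg j.2, enorm_neg]
    · intro j hj hjs
      simp [hjs] at hj
  have h0 : Tendsto (fun s => ‖R s - A‖ₑ ^ 2) atTop (𝓝 0) :=
    tendsto_of_tendsto_of_tendsto_of_le_of_le tendsto_const_nhds
      (ENNReal.tendsto_tsum_compl_atTop_zero h) (fun _ => zero_le) hle
  rw [tendsto_iff_edist_tendsto_0]
  have h1 := h0.ennrpow_const (1 / 2 : ℝ)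
  simp only [edist_eq_enorm_sub]
  refine (h1.congr fun s => ?_).trans (by simp)
  rw [← ENNReal.rpow_natCast, ← ENNReal.rpow_mul]
  norm_num

end HilbertSchmidt

/-! ### Rays and heights in a tree -/

section Geometry

variable {V : Type*} {G : SimpleGraph V} {o : V}

theorem Boundary.adj_ray (ω : Boundary G o) (m : ℕ) : G.Adj (ω.ray m) (ω.ray (m + 1)) :=
  SimpleGraph.dist_eq_one_iff_adj.1 (ω.dist_ray m 1)

theorem Boundary.dist_root_ray (ω : Boundary G o) (m : ℕ) : G.dist o (ω.ray m) = m := by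
  have h := ω.dist_ray 0 m
  rwa [ω.ray_zero, Nat.zero_add] at h

theorem mem_cylinderSet_iff {ω : Boundary G o} {x : V} :
    ω ∈ cylinderSet G o x ↔ ω.ray (G.dist o x) = x := by
  constructor
  · rintro ⟨m, rfl⟩
    rw [ω.dist_root_ray]
  · exact fun h => ⟨_, h⟩

theorem cylinderSet_root : cylinderSet G o o = Set.univ :=
  Set.eq_univ_of_forall fun ω => ⟨0, ω.ray_zero⟩

/-- Once a ray moves away from a vertex, it keeps moving away. -/
theorem Boundary.dist_ray_succ_succ (hG : G.IsTree) (ω : Boundary G o) {x : V} {m : ℕ}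
    (h : G.dist x (ω.ray (m + 1)) = G.dist x (ω.ray m) + 1) :
    G.dist x (ω.ray (m + 1 + 1)) = G.dist x (ω.ray (m + 1)) + 1 := by
  rcases hG.dist_eq_dist_add_one_of_adj x (ω.adj_ray (m + 1)) with h1 | h1
  · have h2 := parent_unique hG (ω.adj_ray m) (ω.adj_ray (m + 1)).symm h h1
    have h3 := ω.dist_ray m 2
    rw [h2, SimpleGraph.dist_self] at h3
    omega
  · exact h1

/-- If a ray approaches `x` in some step, then it has approached `x` in all the steps before. -/
theorem Boundary.dist_ray_of_approach (hG : G.IsTree) (ω : Boundary G o) {x : V} (m : ℕ)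
    (h : G.dist x (ω.ray m) = G.dist x (ω.ray (m + 1)) + 1) :
    G.dist x (ω.ray (m + 1)) + (m + 1) = G.dist o x := by
  induction m with
  | zero => rw [ω.ray_zero, SimpleGraph.dist_comm] at h; omega
  | succ m ih =>
    rcases hG.dist_eq_dist_add_one_of_adj x (ω.adj_ray m) with h1 | h1
    · have := ih h1; omega
    · have := ω.dist_ray_succ_succ hG h1
      omega

theorem Boundary.dist_ray_succ (hG : G.IsTree) (ω : Boundary G o) {x : V} {m : ℕ}
    (hm : G.dist o x ≤ m) : G.dist x (ω.ray (m + 1)) = G.dist x (ω.ray m) + 1 := by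
  rcases hG.dist_eq_dist_add_one_of_adj x (ω.adj_ray m) with h1 | h1
  · have := ω.dist_ray_of_approach hG m h1; omega
  · exact h1

/-- The limit that defines the height of `x` is attained from the index `|x|` on. -/
theorem height_eq (hG : G.IsTree) (ω : Boundary G o) {x : V} {m : ℕ} (hm : G.dist o x ≤ m) :
    height ω x = (m : ℤ) - (G.dist x (ω.ray m) : ℤ) := by
  have h1 : ∀ k : ℕ, ((m + k : ℕ) : ℤ) - (G.dist x (ω.ray (m + k)) : ℤ) =
      (m : ℤ) - (G.dist x (ω.ray m) : ℤ) := by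
    intro k
    induction k with
    | zero => simp
    | succ k ih =>
      rw [← ih, ← Nat.add_assoc, ω.dist_ray_succ hG (by omega)]
      push_cast; ring
  refine tendsto_nhds_unique (tendsto_height hG.connected ω x) ?_
  refine tendsto_const_nhds.congr' ?_
  filter_upwards [eventually_ge_atTop m] with j hj
  obtain ⟨k, rfl⟩ := Nat.exists_eq_add_of_le hj
  exact (h1 k).symm

theorem height_root (hG : G.IsTree) (ω : Boundary G o) : height ω o = 0 := by
  rw [height_eq hG ω (m := 0) (by simp), ω.ray_zero]; simp

theorem height_le (hG : G.IsTree) (ω : Boundary G o) (x : V) : height ω x ≤ G.dist o x := by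
  rw [height_eq hG ω le_rfl]; omega

theorem height_of_mem_cylinderSet (hG : G.IsTree) {ω : Boundary G o} {x y : V}
    (hω : ω ∈ cylinderSet G o y) (hxy : G.dist o x ≤ G.dist o y) :
    height ω x = (G.dist o y : ℤ) - (G.dist x y : ℤ) := by
  rw [height_eq hG ω hxy, mem_cylinderSet_iff.1 hω]

variable [G.LocallyFinite] {q : ℕ}

theorem cylinderSet_nonempty (hX : IsHomogeneousTree G q) (y : V) :
    (cylinderSet G o y).Nonempty := by
  rcases eq_or_ne y o with rfl | hy
  · have := nonempty_succ hX y
    exact ⟨rayOfChoice hX.isTree.connected fun x => Classical.choice (this x), 0, rfl⟩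
  · refine nonempty_of_measure_ne_zero (μ := boundaryMeasure hX o) ?_
    have := hX.two_le
    rw [boundaryMeasure_cylinderSet hX hy]
    refine (ENNReal.div_pos (by simp; omega) ?_).ne'
    exact ENNReal.mul_ne_top (by simp) (ENNReal.pow_ne_top (ENNReal.natCast_ne_top q))

/-- If `p` is the parent of `y`, then every path from `y` to another vertex that is not farther from
the root than `y` starts with the step to `p`. -/
theorem dist_eq_dist_parent_add_one (hX : IsHomogeneousTree G q) {v y p : V} (hp : G.Adj p y)
    (dp : G.dist o y = G.dist o p + 1) (hvy : G.dist o v ≤ G.dist o y) (hne : v ≠ y) :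
    G.dist v y = G.dist v p + 1 := by
  -- if a ray through `y` approached `v` in the step from `p` to `y`, it would have done so in
  -- all the steps before, and would have arrived at `v = y`
  obtain ⟨ω, hω⟩ := cylinderSet_nonempty (o := o) hX y
  have h1 := mem_cylinderSet_iff.1 hω
  rw [dp] at h1
  have h2 : ω.ray (G.dist o p) = p := by
    refine parent_unique hX.isTree (o := o) (x := y) ?_ hp ?_ dp
    · have := ω.adj_ray (G.dist o p)
      rwa [h1] at this
    · rw [ω.dist_root_ray, dp]
  rcases hX.isTree.dist_eq_dist_add_one_of_adj v hp with h3 | h3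
  · have h4 := ω.dist_ray_of_approach hX.isTree (x := v) (G.dist o p) (by rw [h1, h2, h3])
    rw [h1] at h4
    exact absurd (hX.isTree.connected.dist_eq_zero_iff.1 (show G.dist v y = 0 by omega)) hne
  · exact h3

theorem height_parent_of_mem (hX : IsHomogeneousTree G q) {ω : Boundary G o} {y p : V}
    (hp : G.Adj p y) (dp : G.dist o y = G.dist o p + 1) (hω : ω ∈ cylinderSet G o y) :
    height ω p = G.dist o p := by
  rw [height_of_mem_cylinderSet hX.isTree hω (by omega), SimpleGraph.dist_eq_one_iff_adj.2 hp, dp]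
  push_cast; ring

theorem height_self_of_mem (hX : IsHomogeneousTree G q) {ω : Boundary G o} {y : V}
    (hω : ω ∈ cylinderSet G o y) : height ω y = G.dist o y := by
  rw [height_of_mem_cylinderSet hX.isTree hω le_rfl]; simp

theorem height_of_notMem (hX : IsHomogeneousTree G q) {ω : Boundary G o} {y p : V}
    (hp : G.Adj p y) (dp : G.dist o y = G.dist o p + 1) (hω : ω ∉ cylinderSet G o y) :
    height ω y = height ω p - 1 := by
  have hne : ω.ray (G.dist o y) ≠ y := fun h => hω (mem_cylinderSet_iff.2 h)
  have h1 := dist_eq_dist_parent_add_one hX hp dp (ω.dist_root_ray _).le hne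
  rw [height_eq hX.isTree ω (x := y) le_rfl,
    height_eq hX.isTree ω (x := p) (m := G.dist o y) (by omega),
    SimpleGraph.dist_comm (u := y) (v := ω.ray _), h1, SimpleGraph.dist_comm (u := p)]
  push_cast; ring

/-- Exactly one neighbour of a vertex is higher than the vertex, the others are lower. -/
theorem sum_zpow_height_neighbors (hX : IsHomogeneousTree G q) (ω : Boundary G o) (x : V) {z : ℂ}
    (hz : z ≠ 0) : ∑ y ∈ G.neighborFinset x, z ^ height ω y = (z + q / z) * z ^ height ω x := by
  classical
  -- far enough on the ray to differ from `x` and to determine the heights of all neighbours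
  set m := G.dist o x + 1 with hm
  set v := ω.ray m with hv
  have hxv : x ≠ v := by
    intro h
    have := ω.dist_root_ray m
    rw [← hv, ← h] at this
    omega
  obtain ⟨p, hp, dp⟩ := exists_parent hX.isTree (o := v) hxv
  have hle : ∀ y, G.Adj x y → G.dist o y ≤ m := fun y hy => by
    have h1 := hX.isTree.connected.dist_triangle (u := o) (v := x) (w := y)
    rw [SimpleGraph.dist_eq_one_iff_adj.2 hy] at h1
    omega
  have hx := height_eq hX.isTree ω (x := x) (m := m) (by omega)
  have h1 : height ω p = height ω x + 1 := by
    rw [hx, height_eq hX.isTree ω (hle p hp.symm), ← hv, SimpleGraph.dist_comm (u := x),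
      SimpleGraph.dist_comm (u := p), dp]
    push_cast; ring
  have h2 : ∀ y ∈ (G.neighborFinset x).erase p, z ^ height ω y = z ^ (height ω x - 1) := by
    intro y hy
    rw [Finset.mem_erase, SimpleGraph.mem_neighborFinset] at hy
    congr 1
    rcases hX.isTree.dist_eq_dist_add_one_of_adj v hy.2 with h3 | h3
    · exact absurd (parent_unique hX.isTree hy.2.symm hp h3 dp) hy.1
    · rw [hx, height_eq hX.isTree ω (hle y hy.2), ← hv, SimpleGraph.dist_comm (u := x),
        SimpleGraph.dist_comm (u := y), h3]
      push_cast; ring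
  have hmem : p ∈ G.neighborFinset x := by rw [SimpleGraph.mem_neighborFinset]; exact hp.symm
  rw [← Finset.add_sum_erase _ _ hmem, Finset.sum_congr rfl h2, Finset.sum_const,
    Finset.card_erase_of_mem hmem, SimpleGraph.card_neighborFinset_eq_degree, hX.regular x, h1,
    zpow_add_one₀ hz, zpow_sub_one₀ hz]
  simp
  ring

theorem countable_of_isHomogeneousTree (hX : IsHomogeneousTree G q) : Countable V := by
  rcases isEmpty_or_nonempty V with h | ⟨⟨o⟩⟩
  · infer_instance
  have hfin : ∀ n, {x | G.dist o x = n}.Finite := by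
    intro n
    induction n with
    | zero =>
      refine (Set.finite_singleton o).subset fun x hx => ?_
      exact (hX.isTree.connected.dist_eq_zero_iff.1 hx).symm
    | succ n ih =>
      refine (ih.biUnion fun x _ => (G.neighborFinset x).finite_toSet).subset fun y hy => ?_
      have hy' : G.dist o y = n + 1 := hy
      have hne : y ≠ o := by rintro rfl; simp at hy'
      obtain ⟨p, hp, dp⟩ := exists_parent hX.isTree hne
      exact Set.mem_biUnion (show G.dist o p = n by omega) (by simpa using hp)
  have : (⋃ n, {x | G.dist o x = n}) = Set.univ :=
    Set.eq_univ_of_forall fun x => Set.mem_iUnion.2 ⟨_, rfl⟩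
  rw [← Set.countable_univ_iff, ← this]
  exact Set.countable_iUnion fun n => (hfin n).countable

/-- Two cylinders are nested or disjoint. -/
theorem isPiSystem_cylinderSet (hX : IsHomogeneousTree G q) :
    IsPiSystem (Set.range (cylinderSet G o)) := by
  suffices h : ∀ x y : V, G.dist o x ≤ G.dist o y →
      (cylinderSet G o x ∩ cylinderSet G o y).Nonempty →
      cylinderSet G o y ⊆ cylinderSet G o x by
    rintro _ ⟨x, rfl⟩ _ ⟨y, rfl⟩ hne
    rcases le_total (G.dist o x) (G.dist o y) with hxy | hxy
    · exact ⟨y, (Set.inter_eq_right.2 (h x y hxy hne)).symm⟩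
    · exact ⟨x, (Set.inter_eq_left.2 (h y x hxy (by rwa [Set.inter_comm]))).symm⟩
  rintro x y hxy ⟨ω, hx, hy⟩ ω' hy'
  rcases eq_or_ne x o with rfl | hxo
  · rw [cylinderSet_root]; trivial
  by_contra hx'
  obtain ⟨p, hp, dp⟩ := exists_parent hX.isTree hxo
  have h1 := height_of_mem_cylinderSet hX.isTree hy hxy
  have h2 := height_of_mem_cylinderSet hX.isTree hy' hxy
  have h3 := height_self_of_mem hX hx
  have h4 := height_of_notMem hX hp dp hx'
  have h5 := height_le hX.isTree ω' p
  omega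

end Geometry

/-! ### Plane waves -/

section Waves

variable {V : Type*} {G : SimpleGraph V} {o : V} {q : ℕ}

/-- The base `q^{1/2 + is}` of the plane waves. -/
def waveBase (q : ℕ) (s : ℝ) : ℂ := (q : ℂ) ^ (1 / 2 + Complex.I * (s : ℂ))

theorem wavePlus_eq_zpow (q : ℕ) (ω : Boundary G o) (s : ℝ) (x : V) :
    wavePlus q ω s x = waveBase q s ^ height ω x :=
  Complex.cpow_mul_int _ _ _

theorem norm_waveBase (hq : 0 < q) (s : ℝ) : ‖waveBase q s‖ = √q := by
  rw [waveBase, Complex.norm_natCast_cpow_of_pos hq, Real.sqrt_eq_rpow]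
  simp

theorem waveBase_ne_zero (hq : 0 < q) (s : ℝ) : waveBase q s ≠ 0 := by
  rw [← norm_pos_iff, norm_waveBase hq]
  exact Real.sqrt_pos.2 (by exact_mod_cast hq)

theorem waveBase_mul_conj (hq : 0 < q) (s : ℝ) :
    waveBase q s * conj (waveBase q s) = q := by
  rw [Complex.mul_conj', norm_waveBase hq]
  norm_cast
  exact Real.sq_sqrt (Nat.cast_nonneg q)

theorem waveBase_eq (hq : 0 < q) (s : ℝ) :
    waveBase q s = (√q : ℝ) * Complex.exp ((s * Real.log q : ℝ) * Complex.I) := by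
  have hq0 : (q : ℂ) ≠ 0 := by exact_mod_cast hq.ne'
  rw [waveBase, Complex.cpow_add _ _ hq0]
  congr 1
  · rw [Real.sqrt_eq_rpow, Complex.ofReal_cpow (Nat.cast_nonneg q)]
    norm_num
  · rw [Complex.cpow_def_of_ne_zero hq0, ← Complex.natCast_log]
    congr 1
    push_cast; ring

theorem waveMinus_eq_conj (q : ℕ) (ω : Boundary G o) (s : ℝ) (x : V) :
    waveMinus q ω s x = conj (wavePlus q ω s x) := by
  have h := Complex.cpow_conj (q : ℂ) ((1 / 2 + Complex.I * (s : ℂ)) * ((height ω x : ℤ) : ℂ))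
    (by rw [Complex.natCast_arg]; exact Real.pi_pos.ne)
  rw [Complex.conj_natCast] at h
  rw [wavePlus, ← h, waveMinus]
  simp only [map_mul, map_add, map_div₀, map_one, Complex.conj_ofNat, Complex.conj_I,
    Complex.conj_ofReal, map_intCast, neg_mul, sub_eq_add_neg]

/-- `2 √q cos (s log q)`, the eigenvalue of the adjacency operator on the plane waves with parameter
`s`. -/
def waveEigenvalue (q : ℕ) (s : ℝ) : ℝ := 2 * √q * Real.cos (s * Real.log q)

theorem waveBase_add_div (hq : 0 < q) (s : ℝ) :
    waveBase q s + q / waveBase q s = waveEigenvalue q s := by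
  rw [← waveBase_mul_conj hq s, mul_div_cancel_left₀ _ (waveBase_ne_zero hq s), Complex.add_conj,
    waveBase_eq hq, Complex.re_ofReal_mul, Complex.exp_ofReal_mul_I_re, waveEigenvalue]
  push_cast; ring

theorem wavePlus_root (hG : G.IsTree) (ω : Boundary G o) (s : ℝ) : wavePlus q ω s o = 1 := by
  rw [wavePlus_eq_zpow, height_root hG, zpow_zero]

theorem measurableSet_cylinderSet (x : V) : MeasurableSet (cylinderSet G o x) :=
  MeasurableSpace.measurableSet_generateFrom ⟨x, rfl⟩

variable [G.LocallyFinite]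

/-- Along an edge away from the root, the height changes by `-1` except on the cylinder below the
edge. -/
theorem zpow_height_eq_add_indicator (hX : IsHomogeneousTree G q) {z : ℂ} (hz : z ≠ 0)
    (ω : Boundary G o) {y p : V} (hp : G.Adj p y) (dp : G.dist o y = G.dist o p + 1) :
    z ^ height ω y = z⁻¹ * z ^ height ω p +
      (cylinderSet G o y).indicator (fun _ => (1 - z⁻¹ ^ 2) * z ^ G.dist o y) ω := by
  by_cases h : ω ∈ cylinderSet G o y
  · rw [Set.indicator_of_mem h, height_self_of_mem hX h, height_parent_of_mem hX hp dp h, dp]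
    push_cast
    rw [zpow_add_one₀ hz, zpow_natCast]
    field_simp
    ring
  · rw [Set.indicator_of_notMem h, height_of_notMem hX hp dp h, zpow_sub_one₀ hz]
    ring

theorem wavePlus_eq_add_indicator (hX : IsHomogeneousTree G q) (ω : Boundary G o) (s : ℝ) {y p : V}
    (hp : G.Adj p y) (dp : G.dist o y = G.dist o p + 1) :
    wavePlus q ω s y = (waveBase q s)⁻¹ * wavePlus q ω s p + (cylinderSet G o y).indicator
      (fun _ => (1 - (waveBase q s)⁻¹ ^ 2) * waveBase q s ^ G.dist o y) ω := by
  have := hX.two_le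
  simp only [wavePlus_eq_zpow]
  exact zpow_height_eq_add_indicator hX (waveBase_ne_zero (by omega) s) ω hp dp

theorem sum_wavePlus_neighbors (hX : IsHomogeneousTree G q) (ω : Boundary G o) (s : ℝ) (x : V) :
    ∑ y ∈ G.neighborFinset x, wavePlus q ω s y = waveEigenvalue q s * wavePlus q ω s x := by
  have := hX.two_le
  simp only [wavePlus_eq_zpow]
  rw [sum_zpow_height_neighbors hX ω x (waveBase_ne_zero (by omega) s), waveBase_add_div (by omega)]

theorem norm_wavePlus_le (hX : IsHomogeneousTree G q) (ω : Boundary G o) (s : ℝ) (x : V) :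
    ‖wavePlus q ω s x‖ ≤ √q ^ G.dist o x := by
  have := hX.two_le
  rw [wavePlus_eq_zpow, norm_zpow, norm_waveBase (by omega), ← zpow_natCast]
  exact zpow_le_zpow_right₀ (Real.one_le_sqrt.2 (by norm_cast; omega)) (height_le hX.isTree ω x)

theorem measurable_height (hX : IsHomogeneousTree G q) (x : V) :
    Measurable fun ω : Boundary G o => height ω x := by
  classical
  suffices h : ∀ n, ∀ x, G.dist o x = n → Measurable fun ω : Boundary G o => height ω x from
    h _ x rfl
  intro n
  induction n with
  | zero =>
    intro x hx
    obtain rfl := hX.isTree.connected.dist_eq_zero_iff.1 hx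
    simp only [height_root hX.isTree]
    exact measurable_const
  | succ n ih =>
    intro x hx
    have hne : x ≠ o := by rintro rfl; simp at hx
    obtain ⟨p, hp, dp⟩ := exists_parent hX.isTree hne
    have h1 : (fun ω : Boundary G o => height ω x) =
        fun ω => if ω ∈ cylinderSet G o x then (G.dist o x : ℤ) else height ω p - 1 := by
      funext ω
      split_ifs with h
      · exact height_self_of_mem hX h
      · exact height_of_notMem hX hp dp h
    rw [h1]
    exact Measurable.ite (measurableSet_cylinderSet x) measurable_const
      ((ih p (by omega)).sub_const 1)

theorem measurable_wavePlus (hX : IsHomogeneousTree G q) (x : V) :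
    Measurable fun p : Boundary G o × ℝ => wavePlus q p.1 p.2 x := by
  have h := (measurable_height (o := o) hX x).comp
    (measurable_fst : Measurable (Prod.fst : Boundary G o × ℝ → _))
  have h2 : Measurable fun p : Boundary G o × ℝ => ((height p.1 x : ℤ) : ℂ) :=
    (measurable_from_top (f := fun n : ℤ => (n : ℂ))).comp h
  unfold wavePlus
  fun_prop

/-! ### Integrals over the boundary -/

theorem boundaryMeasure_real_cylinderSet (hX : IsHomogeneousTree G q) {x : V} (hx : x ≠ o) :
    (boundaryMeasure hX o).real (cylinderSet G o x) = q / ((q + 1) * q ^ G.dist o x) := by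
  rw [measureReal_def, boundaryMeasure_cylinderSet hX hx]
  simp [ENNReal.toReal_add]

theorem integrable_wavePlus (hX : IsHomogeneousTree G q) (s : ℝ) (x : V) :
    Integrable (fun ω => wavePlus q ω s x) (boundaryMeasure hX o) :=
  Integrable.of_bound ((measurable_wavePlus hX x).comp measurable_prodMk_right).aestronglyMeasurable _
    (Eventually.of_forall fun ω => norm_wavePlus_le hX ω s x)

theorem integrable_wavePlus_mul_conj (hX : IsHomogeneousTree G q) (s : ℝ) (x y : V) :
    Integrable (fun ω => wavePlus q ω s x * conj (wavePlus q ω s y)) (boundaryMeasure hX o) := by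
  refine (integrable_wavePlus hX s x).mul_bdd (c := √q ^ G.dist o y) ?_ ?_
  · exact (Complex.continuous_conj.measurable.comp
      ((measurable_wavePlus hX y).comp measurable_prodMk_right)).aestronglyMeasurable
  · exact Eventually.of_forall fun ω => by
      rw [RCLike.norm_conj]; exact norm_wavePlus_le hX ω s y

/-- The function `q ^ h_ω(x)`, the Poisson kernel, has integral `1`. -/
theorem integral_wavePlus_mul_conj_self (hX : IsHomogeneousTree G q) (s : ℝ) (x : V) :
    ∫ ω, wavePlus q ω s x * conj (wavePlus q ω s x) ∂boundaryMeasure hX o = 1 := by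
  have hq := hX.two_le
  have hq0 : (q : ℂ) ≠ 0 := by norm_cast; omega
  have h1 : ∀ x, (fun ω : Boundary G o => wavePlus q ω s x * conj (wavePlus q ω s x)) =
      fun ω => (q : ℂ) ^ height ω x := fun x => by
    funext ω
    rw [wavePlus_eq_zpow, map_zpow₀, ← mul_zpow, waveBase_mul_conj (by omega)]
  suffices h : ∀ n, ∀ x, G.dist o x = n →
      ∫ ω, wavePlus q ω s x * conj (wavePlus q ω s x) ∂boundaryMeasure hX o = 1 from h _ x rfl
  intro n
  induction n with
  | zero =>
    intro x hx
    obtain rfl := hX.isTree.connected.dist_eq_zero_iff.1 hx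
    simp [wavePlus_root hX.isTree]
  | succ n ih =>
    intro x hx
    have hne : x ≠ o := by rintro rfl; simp at hx
    obtain ⟨p, hp, dp⟩ := exists_parent hX.isTree hne
    have hi := integrable_wavePlus_mul_conj (o := o) hX s p p
    have ih' := ih p (by omega)
    rw [h1] at hi ih' ⊢
    simp_rw [zpow_height_eq_add_indicator hX hq0 _ hp dp]
    rw [integral_add (hi.const_mul _)
      ((integrable_const _).indicator (measurableSet_cylinderSet x)), integral_const_mul, ih',
      integral_indicator_const _ (measurableSet_cylinderSet x),
      boundaryMeasure_real_cylinderSet hX hne]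
    have h3 : (q : ℂ) + 1 ≠ 0 := by norm_cast
    rw [Complex.real_smul]
    push_cast
    field_simp
    ring

/-- Step from `y` to its parent `p` in the integral of `W_x conj W_y`, where `W_x` is constant on
the cylinder below `y`. -/
theorem integral_wavePlus_mul_conj_eq (hX : IsHomogeneousTree G q) (s : ℝ) {x y p : V}
    (hp : G.Adj p y) (dp : G.dist o y = G.dist o p + 1) (hxy : G.dist o x ≤ G.dist o y) :
    ∫ ω, wavePlus q ω s x * conj (wavePlus q ω s y) ∂boundaryMeasure hX o =
      conj (waveBase q s)⁻¹ * ∫ ω, wavePlus q ω s x * conj (wavePlus q ω s p) ∂boundaryMeasure hX o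
      + (1 - conj (waveBase q s)⁻¹ ^ 2) * (waveBase q s)⁻¹ ^ G.dist x y * (q / (q + 1)) := by
  have hq := hX.two_le
  have hq0 : (q : ℂ) ≠ 0 := by norm_cast; omega
  have hne : y ≠ o := by rintro rfl; simp at dp
  have hz := waveBase_ne_zero (q := q) (by omega) s
  set z := waveBase q s with hz_def
  have h1 : ∀ ω : Boundary G o, wavePlus q ω s x * conj (wavePlus q ω s y) =
      conj z⁻¹ * (wavePlus q ω s x * conj (wavePlus q ω s p)) +
      (cylinderSet G o y).indicator
        (fun _ => (1 - conj z⁻¹ ^ 2) * z⁻¹ ^ G.dist x y * q ^ G.dist o y) ω := by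
    intro ω
    rw [wavePlus_eq_add_indicator hX ω s hp dp, ← hz_def]
    by_cases h : ω ∈ cylinderSet G o y
    · rw [Set.indicator_of_mem h, Set.indicator_of_mem h, wavePlus_eq_zpow q ω s x, ← hz_def,
        height_of_mem_cylinderSet hX.isTree h hxy, zpow_sub₀ hz, zpow_natCast, zpow_natCast,
        ← waveBase_mul_conj (q := q) (by omega) s, ← hz_def, mul_pow]
      simp only [map_add, map_mul, map_sub, map_one, map_pow, map_inv₀]
      rw [inv_pow z]
      ring
    · rw [Set.indicator_of_notMem h, Set.indicator_of_notMem h]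
      simp only [map_add, map_mul, map_zero]
      ring
  simp_rw [h1]
  rw [integral_add ((integrable_wavePlus_mul_conj hX s x p).const_mul _)
    ((integrable_const _).indicator (measurableSet_cylinderSet y)), integral_const_mul,
    integral_indicator_const _ (measurableSet_cylinderSet y),
    boundaryMeasure_real_cylinderSet hX hne, Complex.real_smul]
  have h3 : (q : ℂ) + 1 ≠ 0 := by norm_cast
  push_cast
  field_simp

/-- `q sin ((d + 1) θ) - sin ((d - 1) θ)` at `θ = s log q`: up to a factor not depending on `s`, the
product of `sin θ` and the spherical function at distance `d`. -/
def sphericalNumerator (q : ℕ) (d : ℕ) (s : ℝ) : ℝ :=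
  q * Real.sin ((d + 1) * (s * Real.log q)) - Real.sin ((d - 1) * (s * Real.log q))

/-- The recurrence that `integral_wavePlus_mul_conj_eq` imposes on the spherical functions. -/
theorem sphericalNumerator_succ (q d : ℕ) (s : ℝ) :
    (sphericalNumerator q (d + 1) s : ℂ) =
      Complex.exp ((s * Real.log q : ℝ) * Complex.I) * sphericalNumerator q d s +
      Real.sin (s * Real.log q) * (q - Complex.exp ((s * Real.log q : ℝ) * Complex.I) ^ 2) *
        (Complex.exp ((s * Real.log q : ℝ) * Complex.I))⁻¹ ^ (d + 1) := by
  simp only [sphericalNumerator]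
  set θ := s * Real.log q
  have e1 : ∀ k : ℤ, Complex.sin (k * θ) = (Complex.exp (θ * Complex.I) ^ (-k) -
      Complex.exp (θ * Complex.I) ^ k) * Complex.I / 2 := fun k => by
    rw [Complex.sin, ← Complex.exp_int_mul, ← Complex.exp_int_mul]
    push_cast
    ring_nf
  have h0 := e1 1
  have h1 := e1 (d + 2)
  have h2 := e1 d
  have h3 := e1 (d + 1)
  have h4 := e1 (d - 1)
  have hu : Complex.exp (θ * Complex.I) ≠ 0 := Complex.exp_ne_zero _
  set u := Complex.exp (θ * Complex.I)
  have hd : u ^ d ≠ 0 := pow_ne_zero _ hu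
  push_cast at h0 h1 h2 h3 h4 ⊢
  rw [show ((d : ℂ) + 1 + 1) = d + 2 by ring, show ((d : ℂ) + 1 - 1) = d by ring, h1, h2, h3, h4,
    show (θ : ℂ) = 1 * θ by ring, h0]
  simp only [zpow_neg, zpow_sub₀ hu, zpow_add₀ hu, zpow_natCast, zpow_ofNat, inv_pow,
    pow_succ u d]
  field_simp
  ring

/-- The integral of `W_x conj W_y` over the boundary is the spherical function at `d(x, y)`. -/
theorem integral_wavePlus_mul_conj (hX : IsHomogeneousTree G q) (s : ℝ) (x y : V) :
    ((Real.sin (s * Real.log q) * (q + 1) * √q ^ G.dist x y : ℝ) : ℂ) *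
      ∫ ω, wavePlus q ω s x * conj (wavePlus q ω s y) ∂boundaryMeasure hX o =
    sphericalNumerator q (G.dist x y) s := by
  have hq := hX.two_le
  -- the parent of `y` may be closer to the root than `x`, so the induction passes through the
  -- symmetric statement
  let P : V → V → Prop := fun x y =>
    ((Real.sin (s * Real.log q) * (q + 1) * √q ^ G.dist x y : ℝ) : ℂ) *
      ∫ ω, wavePlus q ω s x * conj (wavePlus q ω s y) ∂boundaryMeasure hX o =
    sphericalNumerator q (G.dist x y) s
  have hsymm : ∀ x y : V, P y x → P x y := fun x y h => by
    have h1 := congrArg conj h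
    rw [map_mul, Complex.conj_ofReal, Complex.conj_ofReal, ← integral_conj,
      SimpleGraph.dist_comm] at h1
    simpa only [map_mul, Complex.conj_conj, mul_comm (conj (wavePlus q _ s y)), P] using h1
  suffices h : ∀ n, ∀ x y, G.dist o x + G.dist o y = n → G.dist o x ≤ G.dist o y → P x y by
    rcases le_total (G.dist o x) (G.dist o y) with hxy | hxy
    · exact h _ x y rfl hxy
    · exact hsymm _ _ (h _ y x rfl hxy)
  intro n
  induction n using Nat.strong_induction_on with
  | _ n ih =>
  intro x y hn hxy
  rcases eq_or_ne x y with rfl | hne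
  · change _ * _ = _
    rw [integral_wavePlus_mul_conj_self]
    simp [sphericalNumerator]
    ring
  have hyo : y ≠ o := by
    rintro rfl
    rw [SimpleGraph.dist_self, Nat.le_zero] at hxy
    exact hne (hX.isTree.connected.dist_eq_zero_iff.1 hxy).symm
  obtain ⟨p, hp, dp⟩ := exists_parent hX.isTree hyo
  have hd := dist_eq_dist_parent_add_one hX hp dp hxy hne
  have hrec := integral_wavePlus_mul_conj_eq hX s hp dp hxy
  have ihp : P x p := by
    rcases le_total (G.dist o x) (G.dist o p) with h | h
    · exact ih _ (by omega) x p rfl h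
    · exact hsymm _ _ (ih _ (by omega) p x rfl h)
  simp only [P] at ihp ⊢
  rw [hrec, hd, sphericalNumerator_succ, ← ihp]
  set K := ∫ ω, wavePlus q ω s x * conj (wavePlus q ω s p) ∂boundaryMeasure hX o
  set d := G.dist x p
  set u := Complex.exp ((s * Real.log q : ℝ) * Complex.I) with hu_def
  have hu : u ≠ 0 := Complex.exp_ne_zero _
  have hr : ((√q : ℝ) : ℂ) ≠ 0 := by
    rw [Complex.ofReal_ne_zero]
    exact (Real.sqrt_pos.2 (by norm_cast; omega)).ne'
  have hr2 : ((√q : ℝ) : ℂ) ^ 2 = q := by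
    norm_cast; exact Real.sq_sqrt (Nat.cast_nonneg q)
  have hz : waveBase q s = (√q : ℝ) * u := waveBase_eq (by omega) s
  have hzc : conj (waveBase q s)⁻¹ = u / (√q : ℝ) := by
    rw [map_inv₀, hz, map_mul, Complex.conj_ofReal, hu_def, ← Complex.exp_conj, map_mul,
      Complex.conj_ofReal, Complex.conj_I, mul_neg, Complex.exp_neg, mul_inv, inv_inv]
    ring
  have h3 : (q : ℂ) + 1 ≠ 0 := by norm_cast
  rw [hzc, hz]
  push_cast
  rw [← hr2] at h3 ⊢
  set r := ((√q : ℝ) : ℂ)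
  rw [mul_inv, mul_pow, inv_pow r, pow_succ r]
  field_simp
  ring

end Waves

/-! ### The Plancherel measure -/

section Plancherel

variable {q : ℕ}

theorem log_pos_of_two_le (hq : 2 ≤ q) : 0 < Real.log q :=
  Real.log_pos (by exact_mod_cast hq)

theorem tau_pos (hq : 2 ≤ q) : 0 < tau q := div_pos Real.pi_pos (log_pos_of_two_le hq)

theorem tau_mul_log (hq : 2 ≤ q) : tau q * Real.log q = Real.pi :=
  div_mul_cancel₀ _ (log_pos_of_two_le hq).ne'

/-- `q |q^{1/2 + is} - q^{-1/2 - is}|²`, the numerator of `|c(s)|²` up to a factor. -/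
def plancherelDenom (q : ℕ) (s : ℝ) : ℝ := q ^ 2 + 1 - 2 * q * Real.cos (2 * (s * Real.log q))

/-- The density of the Plancherel measure in closed form. -/
def plancherelWeight (q : ℕ) (s : ℝ) : ℝ :=
  2 * q * (q + 1) * Real.log q / Real.pi * (Real.sin (s * Real.log q) ^ 2 / plancherelDenom q s)

theorem sq_le_plancherelDenom (q : ℕ) (s : ℝ) : ((q : ℝ) - 1) ^ 2 ≤ plancherelDenom q s := by
  have h1 := Real.cos_le_one (2 * (s * Real.log q))
  have h2 : (0 : ℝ) ≤ q := Nat.cast_nonneg q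
  unfold plancherelDenom
  nlinarith

theorem plancherelDenom_pos (hq : 2 ≤ q) (s : ℝ) : 0 < plancherelDenom q s := by
  have h2 : (2 : ℝ) ≤ q := by exact_mod_cast hq
  exact lt_of_lt_of_le (by nlinarith) (sq_le_plancherelDenom q s)

theorem continuous_plancherelWeight (hq : 2 ≤ q) : Continuous (plancherelWeight q) := by
  have h : Continuous (plancherelDenom q) := by unfold plancherelDenom; fun_prop
  unfold plancherelWeight
  exact continuous_const.mul
    (Continuous.div (by fun_prop) h fun s => (plancherelDenom_pos hq s).ne')

theorem plancherelWeight_nonneg (hq : 2 ≤ q) (s : ℝ) : 0 ≤ plancherelWeight q s := by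
  have h1 := (plancherelDenom_pos hq s).le
  have h2 := (log_pos_of_two_le hq).le
  have h3 := Real.pi_pos.le
  unfold plancherelWeight
  positivity

/-- At the end points of `[0, τ]` both sides vanish, so the identity needs no exception. -/
theorem plancherelConst_mul_eq (hq : 2 ≤ q) (s : ℝ) :
    plancherelConst q * (‖cFunction q (s : ℂ)‖ ^ 2)⁻¹ = plancherelWeight q s := by
  have hq0 : (q : ℂ) ≠ 0 := by norm_cast; omega
  have hqr : (q : ℝ) ≠ 0 := by norm_cast; omega
  set θ := s * Real.log q with hθ
  set u := Complex.exp (θ * Complex.I) with hu_def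
  have hu : u ≠ 0 := Complex.exp_ne_zero _
  have hr : √(q : ℝ) ≠ 0 := (Real.sqrt_pos.2 (by norm_cast; omega)).ne'
  have hz : waveBase q s = (√q : ℝ) * u := waveBase_eq (by omega) s
  have hcpow : (q : ℂ) ^ (Complex.I * (s : ℂ)) = u := by
    rw [Complex.cpow_def_of_ne_zero hq0, ← Complex.natCast_log, hu_def, hθ]
    congr 1
    push_cast; ring
  have hsin : u - u⁻¹ = (2 * Real.sin θ : ℝ) * Complex.I := by
    rw [hu_def, ← Complex.exp_neg, ← neg_mul, Complex.exp_mul_I, Complex.exp_mul_I, Complex.cos_neg,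
      Complex.sin_neg]
    push_cast; ring
  have hcos : u ^ 2 + u⁻¹ ^ 2 = (2 * Real.cos (2 * θ) : ℝ) := by
    rw [hu_def, ← Complex.exp_neg, ← Complex.exp_nat_mul, ← Complex.exp_nat_mul]
    push_cast
    rw [Complex.cos]
    ring_nf
  have huc : conj u = u⁻¹ := by
    rw [hu_def, ← Complex.exp_conj, ← Complex.exp_neg]; simp
  have hnum : ‖waveBase q s - (waveBase q s)⁻¹‖ ^ 2 = plancherelDenom q s / q := by
    have h : ((‖waveBase q s - (waveBase q s)⁻¹‖ ^ 2 : ℝ) : ℂ) = (plancherelDenom q s / q : ℝ) := by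
      have hr' : ((√q : ℝ) : ℂ) ≠ 0 := by exact_mod_cast hr
      have hr2 : ((√q : ℝ) : ℂ) ^ 2 = q := by
        norm_cast; exact Real.sq_sqrt (Nat.cast_nonneg q)
      push_cast
      rw [← Complex.mul_conj', hz]
      simp only [map_sub, map_mul, map_inv₀, Complex.conj_ofReal, huc]
      rw [plancherelDenom, ← hθ]
      push_cast at hcos ⊢
      rw [show (2 : ℂ) * q * Complex.cos (2 * θ) = q * (2 * Complex.cos (2 * θ)) by ring, ← hcos,
        ← hr2]
      field_simp
      ring
    exact_mod_cast h
  have hc : ‖cFunction q (s : ℂ)‖ ^ 2 =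
      q / (q + 1) ^ 2 * (plancherelDenom q s / q / (4 * Real.sin θ ^ 2)) := by
    have e1 : (q : ℂ) ^ (-(1 / 2) - Complex.I * (s : ℂ)) = (waveBase q s)⁻¹ := by
      rw [waveBase, ← Complex.cpow_neg]; congr 1; ring
    rw [cFunction, Complex.cpow_neg, e1, hcpow, hsin, ← waveBase, norm_mul, norm_div, norm_div,
      mul_pow, div_pow, div_pow, hnum, Complex.norm_natCast_cpow_of_pos (by omega), norm_mul,
      Complex.norm_I, Complex.norm_real, mul_one, Real.norm_eq_abs, sq_abs]
    have e2 : ‖(q : ℂ) + 1‖ = q + 1 := by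
      rw [← Nat.cast_one, ← Nat.cast_add, Complex.norm_natCast]; push_cast; rfl
    have e3 : ((q : ℝ) ^ ((1 / 2 : ℂ).re)) ^ 2 = q := by
      rw [show (1 / 2 : ℂ).re = 1 / 2 by norm_num, ← Real.sqrt_eq_rpow,
        Real.sq_sqrt (Nat.cast_nonneg q)]
    rw [e2, e3]
    ring
  have hD := (plancherelDenom_pos hq s).ne'
  have hq1 : (q : ℝ) + 1 ≠ 0 := by positivity
  rw [hc, plancherelConst, plancherelWeight, ← hθ]
  rcases eq_or_ne (Real.sin θ) 0 with h0 | h0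
  · simp [h0]
  · field_simp
    ring

theorem plancherelMeasure_eq (hq : 2 ≤ q) : plancherelMeasure q =
    ((volume : Measure ℝ).comap Subtype.val).withDensity
      fun s => ENNReal.ofReal (plancherelWeight q s) := by
  unfold plancherelMeasure
  simp_rw [plancherelConst_mul_eq hq]

theorem integral_plancherelMeasure (hq : 2 ≤ q) (f : ℝ → ℂ) :
    ∫ s, f s ∂plancherelMeasure q = ∫ s in (0)..(tau q), (plancherelWeight q s : ℂ) * f s := by
  have hm : Measurable fun s : Set.Icc 0 (tau q) => ENNReal.ofReal (plancherelWeight q s) :=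
    ((continuous_plancherelWeight hq).comp continuous_subtype_val).measurable.ennreal_ofReal
  rw [plancherelMeasure_eq hq, integral_withDensity_eq_integral_toReal_smul hm
    (Eventually.of_forall fun _ => ENNReal.ofReal_lt_top)]
  simp_rw [ENNReal.toReal_ofReal (plancherelWeight_nonneg hq _), Complex.real_smul]
  rw [integral_subtype_comap measurableSet_Icc
      (fun s : ℝ => (plancherelWeight q s : ℂ) * f s), integral_Icc_eq_integral_Ioc,
    intervalIntegral.integral_of_le (tau_pos hq).le]

theorem isFiniteMeasure_plancherelMeasure (hq : 2 ≤ q) : IsFiniteMeasure (plancherelMeasure q) := by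
  have h1 : IsFiniteMeasure ((volume : Measure ℝ).comap (Subtype.val : Set.Icc 0 (tau q) → ℝ)) := by
    refine ⟨?_⟩
    rw [comap_subtype_coe_apply measurableSet_Icc, Set.image_univ, Subtype.range_coe]
    exact measure_Icc_lt_top
  rw [plancherelMeasure_eq hq]
  refine isFiniteMeasure_withDensity_ofReal ?_
  obtain ⟨C, hC⟩ := (isCompact_Icc (a := 0) (b := tau q)).exists_bound_of_continuousOn
    (continuous_plancherelWeight hq).continuousOn
  exact HasFiniteIntegral.of_bounded (C := C) (Eventually.of_forall fun s => hC s s.2)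

/-- `∫ φ_d dμ` up to a factor, `φ_d` being the spherical function at distance `d`. -/
def sphericalMoment (q d : ℕ) : ℝ :=
  ∫ s in (0)..(tau q), sphericalNumerator q d s * Real.sin (s * Real.log q) / plancherelDenom q s

theorem integral_cos_nat_mul (hq : 2 ≤ q) {k : ℕ} (hk : k ≠ 0) :
    ∫ s in (0)..(tau q), Real.cos (k * (s * Real.log q)) = 0 := by
  have hc : (Real.log q * k) ≠ 0 :=
    mul_ne_zero (log_pos_of_two_le hq).ne' (by exact_mod_cast hk)
  have h := intervalIntegral.integral_comp_mul_right (a := 0) (b := tau q) Real.cos hc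
  rw [integral_cos, ← mul_assoc, tau_mul_log hq, mul_comm Real.pi, Real.sin_nat_mul_pi] at h
  simp only [zero_mul, Real.sin_zero, sub_zero, smul_zero] at h
  rw [← h]
  congr 1; funext s; congr 1; ring

theorem integral_sin_mul_sin (hq : 2 ≤ q) (d : ℕ) :
    ∫ s in (0)..(tau q), Real.sin ((d + 1) * (s * Real.log q)) * Real.sin (s * Real.log q) =
      if d = 0 then tau q / 2 else 0 := by
  have h1 : ∀ s : ℝ, Real.sin ((d + 1) * (s * Real.log q)) * Real.sin (s * Real.log q) =
      1 / 2 * Real.cos (d * (s * Real.log q)) - 1 / 2 * Real.cos ((d + 2 : ℕ) * (s * Real.log q)) := by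
    intro s
    set θ := s * Real.log q
    rw [show (d : ℝ) * θ = (d + 1) * θ - θ by ring,
      show ((d + 2 : ℕ) : ℝ) * θ = (d + 1) * θ + θ by push_cast; ring, Real.cos_sub, Real.cos_add]
    ring
  simp_rw [h1]
  rw [intervalIntegral.integral_sub, intervalIntegral.integral_const_mul,
    intervalIntegral.integral_const_mul, integral_cos_nat_mul hq (Nat.succ_ne_zero (d + 1))]
  · split_ifs with hd
    · subst hd; simp; ring
    · rw [integral_cos_nat_mul hq hd]; ring
  · exact Continuous.intervalIntegrable (by fun_prop) _ _
  · exact Continuous.intervalIntegrable (by fun_prop) _ _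

theorem continuous_sphericalNumerator (q d : ℕ) : Continuous (sphericalNumerator q d) := by
  unfold sphericalNumerator; fun_prop

theorem continuous_plancherelDenom (q : ℕ) : Continuous (plancherelDenom q) := by
  unfold plancherelDenom; fun_prop

theorem sphericalMoment_recurrence (hq : 2 ≤ q) (d : ℕ) :
    q * sphericalMoment q d - sphericalMoment q (d + 2) = if d = 0 then tau q / 2 else 0 := by
  have hcont : ∀ d, Continuous fun s =>
      sphericalNumerator q d s * Real.sin (s * Real.log q) / plancherelDenom q s := fun d =>
    Continuous.div ((continuous_sphericalNumerator q d).mul (by fun_prop))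
      (continuous_plancherelDenom q) fun s => (plancherelDenom_pos hq s).ne'
  rw [← integral_sin_mul_sin hq, sphericalMoment, sphericalMoment,
    ← intervalIntegral.integral_const_mul, ← intervalIntegral.integral_sub]
  · congr 1; funext s
    rw [← mul_div_assoc, ← sub_div, div_eq_iff (plancherelDenom_pos hq s).ne']
    simp only [sphericalNumerator, plancherelDenom]
    set θ := s * Real.log q
    have e1 : Real.sin (((d + 2 : ℕ) + 1) * θ) + Real.sin ((d - 1) * θ) =
        2 * Real.cos (2 * θ) * Real.sin ((d + 1) * θ) := by
      rw [show (((d + 2 : ℕ) : ℝ) + 1) * θ = (d + 1) * θ + 2 * θ by push_cast; ring,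
        show ((d : ℝ) - 1) * θ = (d + 1) * θ - 2 * θ by ring, Real.sin_add, Real.sin_sub]
      ring
    have e2 : Real.sin (((d + 2 : ℕ) - 1) * θ) = Real.sin ((d + 1) * θ) := by
      congr 1; push_cast; ring
    rw [e2]
    linear_combination (-(q : ℝ) * Real.sin θ) * e1
  · exact (continuous_const.mul (hcont d)).intervalIntegrable _ _
  · exact (hcont (d + 2)).intervalIntegrable _ _

theorem abs_sphericalMoment_le (hq : 2 ≤ q) (d : ℕ) :
    |sphericalMoment q d| ≤ (q + 1) / ((q : ℝ) - 1) ^ 2 * tau q := by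
  have hq2 : (2 : ℝ) ≤ q := by exact_mod_cast hq
  have h := intervalIntegral.norm_integral_le_of_norm_le_const (a := 0) (b := tau q)
    (C := (q + 1) / ((q : ℝ) - 1) ^ 2) (f := fun s =>
      sphericalNumerator q d s * Real.sin (s * Real.log q) / plancherelDenom q s) ?_
  · rwa [sub_zero, abs_of_pos (tau_pos hq)] at h
  · intro s _
    have h1 : |sphericalNumerator q d s| ≤ q + 1 := by
      unfold sphericalNumerator
      refine (abs_sub _ _).trans ?_
      rw [abs_mul, Nat.abs_cast]
      have e1 := Real.abs_sin_le_one ((d + 1) * (s * Real.log q))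
      have e2 := Real.abs_sin_le_one ((d - 1) * (s * Real.log q))
      nlinarith
    rw [Real.norm_eq_abs, abs_div, abs_of_pos (plancherelDenom_pos hq s), abs_mul]
    have h3 := Real.abs_sin_le_one (s * Real.log q)
    have h4 : (0 : ℝ) < ((q : ℝ) - 1) ^ 2 := by nlinarith
    refine div_le_div₀ (by positivity) ?_ h4 (sq_le_plancherelDenom q s)
    nlinarith [abs_nonneg (sphericalNumerator q d s), abs_nonneg (Real.sin (s * Real.log q))]

/-- For `d ≥ 1` the recurrence reads `sphericalMoment q (d + 2) = q * sphericalMoment q d`, which is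
compatible with boundedness only if the moments vanish; the value at `0` then follows from the one
at `2`. -/
theorem sphericalMoment_eq (hq : 2 ≤ q) (d : ℕ) :
    sphericalMoment q d = if d = 0 then tau q / (2 * q) else 0 := by
  have hq2 : (2 : ℝ) ≤ q := by exact_mod_cast hq
  have hpos : ∀ d, d ≠ 0 → sphericalMoment q d = 0 := by
    intro d hd
    have h1 : ∀ n : ℕ, sphericalMoment q (d + 2 * n) = q ^ n * sphericalMoment q d := by
      intro n
      induction n with
      | zero => simp
      | succ n ih =>
        have := sphericalMoment_recurrence hq (d + 2 * n)
        rw [if_neg (by omega), ih] at this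
        rw [show d + 2 * (n + 1) = d + 2 * n + 2 by ring, pow_succ]
        linarith
    by_contra hne
    have h2 : Tendsto (fun n : ℕ => (q : ℝ) ^ n * |sphericalMoment q d|) atTop atTop :=
      (tendsto_pow_atTop_atTop_of_one_lt (by linarith)).atTop_mul_const (abs_pos.2 hne)
    obtain ⟨n, hn⟩ := (h2.eventually_gt_atTop ((q + 1) / ((q : ℝ) - 1) ^ 2 * tau q)).exists
    have h3 := abs_sphericalMoment_le hq (d + 2 * n)
    rw [h1, abs_mul, abs_of_pos (by positivity : (0 : ℝ) < (q : ℝ) ^ n)] at h3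
    linarith
  split_ifs with hd
  · subst hd
    have := sphericalMoment_recurrence hq 0
    rw [hpos 2 (by omega), if_pos rfl] at this
    field_simp
    linarith
  · exact hpos d hd

/-- The spherical functions integrate to `0` against the Plancherel measure, except at distance
`0`. -/
theorem integral_spherical_plancherelMeasure (hq : 2 ≤ q) (d : ℕ) {k : ℝ → ℂ}
    (hk : ∀ s, ((Real.sin (s * Real.log q) * (q + 1) * √q ^ d : ℝ) : ℂ) * k s =
      sphericalNumerator q d s) :
    ∫ s, k s ∂plancherelMeasure q = if d = 0 then 1 else 0 := by
  have hr : √(q : ℝ) ^ d ≠ 0 := pow_ne_zero _ (Real.sqrt_pos.2 (by norm_cast; omega)).ne'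
  have h1 : ∀ s, (plancherelWeight q s : ℂ) * k s =
      ((2 * q * Real.log q / (Real.pi * √q ^ d) *
        (sphericalNumerator q d s * Real.sin (s * Real.log q) / plancherelDenom q s) : ℝ) : ℂ) := by
    intro s
    have hD := (plancherelDenom_pos hq s).ne'
    have hD' : (plancherelDenom q s : ℂ) ≠ 0 := by exact_mod_cast hD
    have hr' : ((√q : ℝ) : ℂ) ^ d ≠ 0 := by exact_mod_cast hr
    have hpi : (Real.pi : ℂ) ≠ 0 := by exact_mod_cast Real.pi_ne_zero
    have := hk s
    rw [plancherelWeight]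
    push_cast at this ⊢
    rw [← this]
    field_simp
  rw [integral_plancherelMeasure hq]
  simp_rw [h1]
  rw [intervalIntegral.integral_ofReal, intervalIntegral.integral_const_mul, ← sphericalMoment,
    sphericalMoment_eq hq]
  split_ifs with hd
  · subst hd
    have hL := (log_pos_of_two_le hq).ne'
    have hq0 : (q : ℝ) ≠ 0 := by norm_cast; omega
    have := tau_mul_log hq
    norm_cast
    rw [← this]
    have := (tau_pos hq).ne'
    field_simp
  · simp

/-! ### Determination by the powers of an injective function -/

/-- By the Stone–Weierstrass theorem the powers of an injective continuous function are a
determining family for integrable functions on a compact space. -/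
theorem ae_eq_zero_of_forall_integral_pow_mul {X : Type*} [MetricSpace X] [CompactSpace X]
    [MeasurableSpace X] [BorelSpace X] {μ : Measure X} {g : C(X, ℝ)} (hg : Function.Injective g)
    {Φ : X → ℂ} (hΦ : Integrable Φ μ) (h : ∀ n : ℕ, ∫ x, (g x : ℂ) ^ n * Φ x ∂μ = 0) :
    Φ =ᵐ[μ] 0 := by
  have hint : ∀ f : C(X, ℝ), Integrable (fun x => (f x : ℂ) * Φ x) μ := fun f =>
    hΦ.bdd_mul (c := ‖f‖) (by fun_prop) (Eventually.of_forall fun x => by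
      rw [Complex.norm_real]; exact f.norm_coe_le_norm x)
  let L : C(X, ℝ) →ₗ[ℝ] ℂ :=
    { toFun := fun f => ∫ x, (f x : ℂ) * Φ x ∂μ
      map_add' := fun f₁ f₂ => by
        rw [← integral_add (hint f₁) (hint f₂)]
        simp [add_mul]
      map_smul' := fun c f => by
        rw [RingHom.id_apply, Complex.real_smul, ← integral_const_mul]
        simp [mul_assoc] }
  have hL : Continuous L := by
    refine (L.mkContinuous (∫ x, ‖Φ x‖ ∂μ) fun f => ?_).continuous
    refine (norm_integral_le_integral_norm _).trans ?_
    rw [mul_comm, ← integral_const_mul]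
    refine integral_mono (hint f).norm (hΦ.norm.const_mul _) fun x => ?_
    simp only [norm_mul, Complex.norm_real]
    exact mul_le_mul_of_nonneg_right (f.norm_coe_le_norm x) (norm_nonneg _)
  have hzero : ∀ f, L f = 0 := by
    -- `L` is continuous and vanishes on the dense subalgebra generated by `g`
    have hdense := ContinuousMap.subalgebra_topologicalClosure_eq_top_of_separatesPoints
      (Algebra.adjoin ℝ {g}) fun x y hxy =>
        ⟨g, ⟨g, Algebra.self_mem_adjoin_singleton ℝ g, rfl⟩, fun h => hxy (hg h)⟩
    have hsub : ((Algebra.adjoin ℝ {g} : Subalgebra ℝ C(X, ℝ)) : Set C(X, ℝ)) ⊆ {f | L f = 0} := by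
      intro f hf
      rw [SetLike.mem_coe, Algebra.adjoin_singleton_eq_range_aeval] at hf
      obtain ⟨P, rfl⟩ := hf
      change L (Polynomial.aeval g P) = 0
      rw [Polynomial.aeval_eq_sum_range, map_sum]
      refine Finset.sum_eq_zero fun n _ => ?_
      rw [map_smul]
      have : L (g ^ n) = 0 := by simpa [L] using h n
      rw [this, smul_zero]
    have hcl := closure_minimal hsub (isClosed_eq hL continuous_const)
    intro f
    have hf : f ∈ (Algebra.adjoin ℝ {g} : Subalgebra ℝ C(X, ℝ)).topologicalClosure := by
      rw [hdense]; trivial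
    exact hcl hf
  -- indicators of closed sets are bounded pointwise limits of continuous functions
  refine ae_eq_zero_of_forall_setIntegral_isClosed_eq_zero hΦ fun s hs => ?_
  have hlim : Tendsto (fun n => ∫ x, ((hs.apprSeq n x : ℝ) : ℂ) * Φ x ∂μ) atTop
      (𝓝 (∫ x, s.indicator Φ x ∂μ)) := by
    refine tendsto_integral_of_dominated_convergence (fun x => ‖Φ x‖) (fun n => ?_) hΦ.norm
      (fun n => ?_) ?_
    · exact (hint ⟨fun x => (hs.apprSeq n x : ℝ), by fun_prop⟩).aestronglyMeasurable
    · refine Eventually.of_forall fun x => ?_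
      rw [norm_mul, Complex.norm_real, NNReal.norm_eq]
      exact mul_le_of_le_one_left (norm_nonneg _)
        (by exact_mod_cast HasOuterApproxClosed.apprSeq_apply_le_one hs n x)
    · refine Eventually.of_forall fun x => ?_
      have h1 := (tendsto_pi_nhds.1 (HasOuterApproxClosed.tendsto_apprSeq hs)) x
      have h2 := (((Complex.continuous_ofReal.comp NNReal.continuous_coe).tendsto _).comp
        h1).mul_const (Φ x)
      have h3 : s.indicator Φ x =
          (((s.indicator (fun _ => (1 : NNReal)) x : NNReal) : ℝ) : ℂ) * Φ x := by
        by_cases hx : x ∈ s <;> simp [hx]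
      rw [h3]
      exact h2
  rw [← integral_indicator hs.measurableSet]
  refine tendsto_nhds_unique hlim (tendsto_const_nhds.congr fun n => ?_)
  exact (hzero ⟨fun x => (hs.apprSeq n x : ℝ), by fun_prop⟩).symm

end Plancherel

/-! ### The plane waves as an orthonormal basis -/

section Basis

variable {V : Type*} {G : SimpleGraph V} {o : V} {q : ℕ} [G.LocallyFinite]

theorem integrable_conj {α : Type*} [MeasurableSpace α] {μ : Measure α} {f : α → ℂ}
    (hf : Integrable f μ) : Integrable (fun a => conj (f a)) μ :=
  hf.mono (Complex.continuous_conj.comp_aestronglyMeasurable hf.1)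
    (Eventually.of_forall fun a => by rw [RCLike.norm_conj])

theorem measurable_wavePlus_subtype (hX : IsHomogeneousTree G q) (x : V) :
    Measurable fun p : Boundary G o × Set.Icc (0 : ℝ) (tau q) => wavePlus q p.1 p.2 x := by
  have h : Measurable fun p : Boundary G o × Set.Icc (0 : ℝ) (tau q) => (p.1, (p.2 : ℝ)) :=
    measurable_fst.prodMk (measurable_subtype_coe.comp measurable_snd)
  simpa only [Function.comp_def] using (measurable_wavePlus (o := o) hX x).comp h

/-- Plane waves are bounded for a fixed vertex, so products with them stay integrable. -/
theorem integrable_mul_wavePlus (hX : IsHomogeneousTree G q)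
    {F : Boundary G o × Set.Icc (0 : ℝ) (tau q) → ℂ}
    (hF : Integrable F ((boundaryMeasure hX o).prod (plancherelMeasure q))) (x : V) :
    Integrable (fun p => F p * wavePlus q p.1 p.2 x)
      ((boundaryMeasure hX o).prod (plancherelMeasure q)) :=
  hF.mul_bdd (c := √q ^ G.dist o x) (measurable_wavePlus_subtype hX x).aestronglyMeasurable
    (Eventually.of_forall fun p => norm_wavePlus_le hX p.1 p.2 x)

theorem continuous_waveEigenvalue (q : ℕ) : Continuous (waveEigenvalue q) := by
  unfold waveEigenvalue; fun_prop

theorem injOn_waveEigenvalue (hq : 2 ≤ q) : Set.InjOn (waveEigenvalue q) (Set.Icc 0 (tau q)) := by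
  intro s hs t ht h
  have hL := log_pos_of_two_le hq
  have hr : (2 * √(q : ℝ)) ≠ 0 := mul_ne_zero two_ne_zero (Real.sqrt_pos.2 (by norm_cast; omega)).ne'
  have hmem : ∀ s ∈ Set.Icc 0 (tau q), s * Real.log q ∈ Set.Icc 0 Real.pi := fun s hs => by
    rw [← tau_mul_log hq]
    exact ⟨mul_nonneg hs.1 hL.le, mul_le_mul_of_nonneg_right hs.2 hL.le⟩
  exact mul_right_cancel₀ hL.ne'
    (Real.injOn_cos (hmem s hs) (hmem t ht) (mul_left_cancel₀ hr h))

/-- A function on the boundary whose integrals over all the cylinders vanish is null. -/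
theorem ae_eq_zero_of_forall_integral_cylinderSet (hX : IsHomogeneousTree G q) {f : Boundary G o → ℂ}
    (hf : Integrable f (boundaryMeasure hX o))
    (h : ∀ x, ∫ ω in cylinderSet G o x, f ω ∂boundaryMeasure hX o = 0) :
    f =ᵐ[boundaryMeasure hX o] 0 := by
  have huniv : ∫ ω, f ω ∂boundaryMeasure hX o = 0 := by
    have := h o
    rwa [cylinderSet_root, Measure.restrict_univ] at this
  refine hf.ae_eq_zero_of_forall_setIntegral_eq_zero fun s hs _ => ?_
  induction s, hs using MeasurableSpace.induction_on_inter rfl (isPiSystem_cylinderSet hX) with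
  | empty => simp
  | basic t ht => obtain ⟨x, rfl⟩ := ht; exact h x
  | compl t ht ih =>
    have ih := ih (measure_lt_top _ _)
    rw [setIntegral_compl ht hf, ih, huniv, sub_zero]
  | iUnion t hd ht ih =>
    rw [integral_iUnion ht hd hf.integrableOn]
    simp [ih _ (measure_lt_top _ _)]

/-- The plane waves form a determining family for integrable functions. Since they are
eigenfunctions of the adjacency operator, the orthogonality to all of them is preserved under multiplication by
the eigenvalue, whose powers separate the parameters. -/
theorem ae_eq_zero_of_forall_integral_mul_wavePlus (hX : IsHomogeneousTree G q)
    {F : Boundary G o × Set.Icc (0 : ℝ) (tau q) → ℂ}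
    (hF : Integrable F ((boundaryMeasure hX o).prod (plancherelMeasure q)))
    (h : ∀ x, ∫ p, F p * wavePlus q p.1 p.2 x
      ∂((boundaryMeasure hX o).prod (plancherelMeasure q)) = 0) :
    F =ᵐ[(boundaryMeasure hX o).prod (plancherelMeasure q)] 0 := by
  have hq := hX.two_le
  have := isFiniteMeasure_plancherelMeasure hq
  have := countable_of_isHomogeneousTree hX
  have hFW := integrable_mul_wavePlus hX hF
  let g : C(Set.Icc (0 : ℝ) (tau q), ℝ) :=
    ⟨fun s => waveEigenvalue q s, (continuous_waveEigenvalue q).comp continuous_subtype_val⟩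
  have hgb : ∀ n x, Integrable (fun p : Boundary G o × Set.Icc (0 : ℝ) (tau q) =>
      (g p.2 : ℂ) ^ n * (F p * wavePlus q p.1 p.2 x))
      ((boundaryMeasure hX o).prod (plancherelMeasure q)) := fun n x => by
    refine (hFW x).bdd_mul (c := ‖g‖ ^ n) ?_ ?_
    · exact (Measurable.pow_const (by fun_prop) n).aestronglyMeasurable
    · refine Eventually.of_forall fun p => ?_
      rw [norm_pow, Complex.norm_real]
      exact pow_le_pow_left₀ (norm_nonneg _) (g.norm_coe_le_norm p.2) n
  have hpow : ∀ n x, ∫ p, (g p.2 : ℂ) ^ n * (F p * wavePlus q p.1 p.2 x)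
      ∂((boundaryMeasure hX o).prod (plancherelMeasure q)) = 0 := by
    intro n
    induction n with
    | zero => intro x; simpa using h x
    | succ n ih =>
      intro x
      have h1 : ∀ p : Boundary G o × Set.Icc (0 : ℝ) (tau q),
          (g p.2 : ℂ) ^ (n + 1) * (F p * wavePlus q p.1 p.2 x) =
          ∑ y ∈ G.neighborFinset x, (g p.2 : ℂ) ^ n * (F p * wavePlus q p.1 p.2 y) := fun p => by
        rw [← Finset.mul_sum, ← Finset.mul_sum, sum_wavePlus_neighbors hX]
        change _ = (g p.2 : ℂ) ^ n * (F p * ((g p.2 : ℂ) * wavePlus q p.1 p.2 x))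
        ring
      simp_rw [h1]
      rw [integral_finsetSum _ fun y _ => hgb n y]
      exact Finset.sum_eq_zero fun y _ => ih y
  have hΦ : ∀ x, (fun s : Set.Icc (0 : ℝ) (tau q) =>
      ∫ ω, F (ω, s) * wavePlus q ω s x ∂boundaryMeasure hX o) =ᵐ[plancherelMeasure q] 0 := by
    intro x
    refine ae_eq_zero_of_forall_integral_pow_mul (g := g) ?_ (hFW x).integral_prod_right fun n => ?_
    · intro s t hst
      exact Subtype.ext (injOn_waveEigenvalue hq s.2 t.2 hst)
    · simp_rw [← integral_const_mul]
      rw [← hpow n x, integral_prod_symm _ (hgb n x)]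
  have hsec : ∀ᵐ s ∂plancherelMeasure q, ∀ᵐ ω ∂boundaryMeasure hX o, F (ω, s) = 0 := by
    -- compare the vanishing integrals of `F W_y` and `F W_p`, where `p` is the parent of `y`
    filter_upwards [ae_all_iff.2 hΦ, hF.prod_left_ae] with s hs hint
    refine ae_eq_zero_of_forall_integral_cylinderSet hX hint fun y => ?_
    rcases eq_or_ne y o with rfl | hy
    · have h1 := hs y
      simp only [wavePlus_root hX.isTree, mul_one, Pi.zero_apply] at h1
      rwa [cylinderSet_root, Measure.restrict_univ]
    obtain ⟨p, hp, dp⟩ := exists_parent hX.isTree hy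
    have hz := waveBase_ne_zero (q := q) (by omega) s
    have hy1 : ∫ ω, F (ω, s) * wavePlus q ω s y ∂boundaryMeasure hX o = 0 := hs y
    have hp1 : ∫ ω, F (ω, s) * wavePlus q ω s p ∂boundaryMeasure hX o = 0 := hs p
    set z := waveBase q s with hz_def
    have h1 : ∀ ω : Boundary G o, F (ω, s) * wavePlus q ω s y =
        z⁻¹ * (F (ω, s) * wavePlus q ω s p) + (1 - z⁻¹ ^ 2) * z ^ G.dist o y *
          (cylinderSet G o y).indicator (fun ω => F (ω, s)) ω := by
      intro ω
      rw [wavePlus_eq_add_indicator hX ω s hp dp, ← hz_def]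
      by_cases hω : ω ∈ cylinderSet G o y
      · rw [Set.indicator_of_mem hω, Set.indicator_of_mem hω]; ring
      · rw [Set.indicator_of_notMem hω, Set.indicator_of_notMem hω]; ring
    have hip : Integrable (fun ω => F (ω, s) * wavePlus q ω s p) (boundaryMeasure hX o) :=
      hint.mul_bdd (c := √q ^ G.dist o p)
        ((measurable_wavePlus hX p).comp measurable_prodMk_right).aestronglyMeasurable
        (Eventually.of_forall fun ω => norm_wavePlus_le hX ω s p)
    simp_rw [h1] at hy1
    rw [integral_add (hip.const_mul _)
      ((hint.indicator (measurableSet_cylinderSet y)).const_mul _), integral_const_mul, hp1,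
      mul_zero, zero_add, integral_const_mul, integral_indicator (measurableSet_cylinderSet y)] at hy1
    refine (mul_eq_zero.1 hy1).resolve_left (mul_ne_zero ?_ (pow_ne_zero _ hz))
    -- `|z⁻²| = 1 / q < 1`
    intro h0
    have h2 : ‖z⁻¹ ^ 2‖ = 1 := by rw [← sub_eq_zero.1 h0, norm_one]
    rw [norm_pow, norm_inv, hz_def, norm_waveBase (by omega), inv_pow,
      Real.sq_sqrt (Nat.cast_nonneg q), inv_eq_one] at h2
    norm_cast at h2
    omega
  have hnorm : ∫ p, ‖F p‖ ∂((boundaryMeasure hX o).prod (plancherelMeasure q)) = 0 := by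
    rw [integral_prod_symm _ hF.norm]
    refine integral_eq_zero_of_ae ?_
    filter_upwards [hsec] with s hs
    refine integral_eq_zero_of_ae ?_
    filter_upwards [hs] with ω hω
    simp [hω]
  rw [integral_eq_zero_iff_of_nonneg (fun _ => norm_nonneg _) hF.norm] at hnorm
  filter_upwards [hnorm] with p hp
  simpa using hp

theorem integral_wavePlus_mul_conj_wavePlus (hX : IsHomogeneousTree G q) [DecidableEq V] (x y : V) :
    ∫ p : Boundary G o × Set.Icc (0 : ℝ) (tau q),
      wavePlus q p.1 p.2 x * conj (wavePlus q p.1 p.2 y)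
      ∂((boundaryMeasure hX o).prod (plancherelMeasure q)) = if x = y then 1 else 0 := by
  have hq := hX.two_le
  have := isFiniteMeasure_plancherelMeasure hq
  have hint : Integrable (fun p : Boundary G o × Set.Icc (0 : ℝ) (tau q) =>
      wavePlus q p.1 p.2 x * conj (wavePlus q p.1 p.2 y))
      ((boundaryMeasure hX o).prod (plancherelMeasure q)) := by
    refine Integrable.of_bound ((measurable_wavePlus_subtype hX x).mul
      (Complex.continuous_conj.measurable.comp
        (measurable_wavePlus_subtype hX y))).aestronglyMeasurable
      (√q ^ G.dist o x * √q ^ G.dist o y) (Eventually.of_forall fun p => ?_)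
    rw [norm_mul, RCLike.norm_conj]
    exact mul_le_mul (norm_wavePlus_le hX _ _ x) (norm_wavePlus_le hX _ _ y) (norm_nonneg _)
      (by positivity)
  rw [integral_prod_symm _ hint]
  have h1 := integral_spherical_plancherelMeasure hq (G.dist x y)
    (fun s => integral_wavePlus_mul_conj (o := o) hX s x y)
  rw [h1]
  simp only [hX.isTree.connected.dist_eq_zero_iff]

/-- The plane waves `W_y` form an orthonormal basis of `L²(ν × μ)`. -/
theorem exists_hilbertBasis_wavePlus (hX : IsHomogeneousTree G q) (o : V) :
    ∃ e : HilbertBasis V ℂ (Lp ℂ 2 ((boundaryMeasure hX o).prod (plancherelMeasure q))),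
      ∀ y, e y =ᵐ[(boundaryMeasure hX o).prod (plancherelMeasure q)]
        fun p => wavePlus q p.1 p.2 y := by
  classical
  have := isFiniteMeasure_plancherelMeasure hX.two_le
  have hm : ∀ y, MemLp (fun p : Boundary G o × Set.Icc (0 : ℝ) (tau q) => wavePlus q p.1 p.2 y) 2
      ((boundaryMeasure hX o).prod (plancherelMeasure q)) := fun y =>
    MemLp.of_bound (measurable_wavePlus_subtype hX y).aestronglyMeasurable _
      (Eventually.of_forall fun p => norm_wavePlus_le hX p.1 p.2 y)
  let w := fun y => (hm y).toLp
  have hw : ∀ y, w y =ᵐ[_] _ := fun y => (hm y).coeFn_toLp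
  have hon : Orthonormal ℂ w := by
    rw [orthonormal_iff_ite]
    intro x y
    rw [L2.inner_def]
    simp_rw [eq_comm (a := x)]
    rw [← integral_wavePlus_mul_conj_wavePlus (o := o) hX y x]
    refine integral_congr_ae ?_
    filter_upwards [hw x, hw y] with p hx hy
    rw [hx, hy, RCLike.inner_apply]
  have hsp : (Submodule.span ℂ (Set.range w))ᗮ = ⊥ := by
    rw [eq_bot_iff]
    intro f hf
    have h1 : ∀ y, ∫ p, conj (f p) * wavePlus q p.1 p.2 y
        ∂((boundaryMeasure hX o).prod (plancherelMeasure q)) = 0 := by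
      intro y
      have h2 : inner ℂ (w y) f = 0 := hf _ (Submodule.subset_span ⟨y, rfl⟩)
      rw [← inner_conj_symm, L2.inner_def, map_eq_zero] at h2
      rw [← h2]
      refine integral_congr_ae ?_
      filter_upwards [hw y] with p hp
      rw [hp, RCLike.inner_apply, mul_comm]
    have h3 := ae_eq_zero_of_forall_integral_mul_wavePlus hX
      (F := fun p => conj (f p)) ?_ h1
    · rw [Submodule.mem_bot, Lp.eq_zero_iff_ae_eq_zero]
      filter_upwards [h3] with p hp
      simpa using hp
    · exact integrable_conj ((Lp.memLp f).integrable (by norm_num))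
  refine ⟨HilbertBasis.mkOfOrthogonalEqBot hon hsp, fun y => ?_⟩
  rw [HilbertBasis.coe_mkOfOrthogonalEqBot]
  exact hw y

end Basis

/-! ### Parseval's identity for integrable functions -/

section Parseval

variable {V : Type*} {G : SimpleGraph V} {o : V} {q : ℕ} [G.LocallyFinite]

theorem eLpNorm_two_sq {α : Type*} [MeasurableSpace α] {μ : Measure α} (f : α → ℂ) :
    eLpNorm f 2 μ ^ 2 = ∫⁻ a, ‖f a‖ₑ ^ 2 ∂μ := by
  rw [eLpNorm_eq_lintegral_rpow_enorm_toReal (by simp) (by simp), ← ENNReal.rpow_natCast,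
    ← ENNReal.rpow_mul]
  simp

theorem eLpNorm_two_lt_top_iff {α : Type*} [MeasurableSpace α] {μ : Measure α} {f : α → ℂ} :
    eLpNorm f 2 μ < ∞ ↔ ∫⁻ a, ‖f a‖ₑ ^ 2 ∂μ ≠ ∞ := by
  rw [← eLpNorm_two_sq, lt_top_iff_ne_top, ne_eq, ne_eq, ENNReal.pow_eq_top_iff]
  simp

/-- Parseval's identity for the plane waves, for all integrable functions: both sides are infinite
unless `F` is square integrable. -/
theorem lintegral_enorm_sq_eq_tsum (hX : IsHomogeneousTree G q)
    {F : Boundary G o × Set.Icc (0 : ℝ) (tau q) → ℂ}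
    (hF : Integrable F ((boundaryMeasure hX o).prod (plancherelMeasure q))) :
    ∫⁻ p, ‖F p‖ₑ ^ 2 ∂((boundaryMeasure hX o).prod (plancherelMeasure q)) =
      ∑' y, ‖∫ p, F p * wavePlus q p.1 p.2 y
        ∂((boundaryMeasure hX o).prod (plancherelMeasure q))‖ₑ ^ 2 := by
  have := isFiniteMeasure_plancherelMeasure hX.two_le
  obtain ⟨e, he⟩ := exists_hilbertBasis_wavePlus hX o
  have hcoef : ∀ f : Lp ℂ 2 ((boundaryMeasure hX o).prod (plancherelMeasure q)), ∀ y,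
      inner ℂ (e y) f = conj (∫ p, conj (f p) * wavePlus q p.1 p.2 y
        ∂((boundaryMeasure hX o).prod (plancherelMeasure q))) := by
    intro f y
    rw [L2.inner_def, ← integral_conj]
    refine integral_congr_ae ?_
    filter_upwards [he y] with p hp
    rw [hp, RCLike.inner_apply, map_mul, Complex.conj_conj]
  have hmem : ∀ f : Lp ℂ 2 ((boundaryMeasure hX o).prod (plancherelMeasure q)),
      (fun p => conj (f p)) =ᵐ[(boundaryMeasure hX o).prod (plancherelMeasure q)] F →
      ∫⁻ p, ‖F p‖ₑ ^ 2 ∂((boundaryMeasure hX o).prod (plancherelMeasure q)) =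
      ∑' y, ‖∫ p, F p * wavePlus q p.1 p.2 y
        ∂((boundaryMeasure hX o).prod (plancherelMeasure q))‖ₑ ^ 2 := by
    intro f hf
    have h1 := e.enorm_sq_eq_tsum f
    rw [Lp.enorm_def, eLpNorm_two_sq] at h1
    have h2 : ∫⁻ p, ‖F p‖ₑ ^ 2 ∂((boundaryMeasure hX o).prod (plancherelMeasure q)) =
        ∫⁻ p, ‖f p‖ₑ ^ 2 ∂((boundaryMeasure hX o).prod (plancherelMeasure q)) := by
      refine lintegral_congr_ae ?_
      filter_upwards [hf] with p hp
      rw [← hp, RCLike.enorm_conj]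
    rw [h2, h1]
    refine tsum_congr fun y => ?_
    rw [hcoef, RCLike.enorm_conj]
    congr 2
    refine integral_congr_ae ?_
    filter_upwards [hf] with p hp
    rw [hp]
  by_cases h : ∑' y, ‖∫ p, F p * wavePlus q p.1 p.2 y
        ∂((boundaryMeasure hX o).prod (plancherelMeasure q))‖ₑ ^ 2 = ∞
  · by_contra hne
    rw [h] at hne
    have hL2 : MemLp (fun p => conj (F p)) 2
        ((boundaryMeasure hX o).prod (plancherelMeasure q)) := by
      refine ⟨(integrable_conj hF).1, ?_⟩
      rw [eLpNorm_two_lt_top_iff]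
      simp_rw [RCLike.enorm_conj]
      exact hne
    refine hne ((hmem hL2.toLp ?_).trans h)
    filter_upwards [hL2.coeFn_toLp] with p hp
    rw [hp, Complex.conj_conj]
  · -- the coefficients of `conj F` belong to an element of `L²`, which has to be `conj F`
    have hc : Memℓp (fun y => conj (∫ p, F p * wavePlus q p.1 p.2 y
        ∂((boundaryMeasure hX o).prod (plancherelMeasure q)))) 2 := by
      refine memℓp_gen ?_
      have h1 := ENNReal.summable_toReal h
      simpa using h1
    let f := e.repr.symm ⟨_, hc⟩
    refine hmem f ?_
    have hf : ∀ y, inner ℂ (e y) f = conj (∫ p, F p * wavePlus q p.1 p.2 y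
        ∂((boundaryMeasure hX o).prod (plancherelMeasure q))) := fun y => by
      rw [← e.repr_apply_apply, LinearIsometryEquiv.apply_symm_apply]
    have hfint := integrable_conj ((Lp.memLp f).integrable (by norm_num))
    have hzero := ae_eq_zero_of_forall_integral_mul_wavePlus hX (hfint.sub hF) fun y => ?_
    · filter_upwards [hzero] with p hp
      exact sub_eq_zero.1 hp
    · have h1 := (starRingEnd ℂ).injective ((hcoef f y).symm.trans (hf y))
      simp only [Pi.sub_apply, sub_mul]
      rw [integral_sub (integrable_mul_wavePlus hX hfint y) (integrable_mul_wavePlus hX hF y), h1,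
        sub_self]

end Parseval

/-! ### Pseudo-differential operators -/

section Operator

variable {V : Type*} {G : SimpleGraph V} {o : V} {q : ℕ}

/-- The standard orthonormal basis of `ℓ²`. -/
def ellTwoBasis (V : Type*) : HilbertBasis V ℂ (EllTwo V) :=
  HilbertBasis.ofRepr (LinearIsometryEquiv.refl ℂ (EllTwo V))

theorem inner_ellTwoBasis (x : V) (f : EllTwo V) : inner ℂ (ellTwoBasis V x) f = f x := by
  rw [← HilbertBasis.repr_apply_apply]; rfl

theorem ellTwoBasis_apply [DecidableEq V] (x y : V) :
    ellTwoBasis V x y = if y = x then 1 else 0 := by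
  rw [← inner_ellTwoBasis, orthonormal_iff_ite.1 (ellTwoBasis V).orthonormal]

theorem EllTwo.enorm_sq_eq_tsum (f : EllTwo V) : ‖f‖ₑ ^ 2 = ∑' x, ‖f x‖ₑ ^ 2 := by
  simp_rw [(ellTwoBasis V).enorm_sq_eq_tsum f, inner_ellTwoBasis]

theorem pdoIntegrand_eq_sum (σ : V × Boundary G o × Set.Icc (0 : ℝ) (tau q) → ℂ) (f : V →₀ ℂ)
    (x : V) (p : Boundary G o × Set.Icc (0 : ℝ) (tau q)) :
    pdoIntegrand q σ f x p =
      ∑ y ∈ f.support, f y * (conj (bSymbol q σ (x, p)) * wavePlus q p.1 p.2 y) := by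
  rw [pdoIntegrand, helgasonTransform, Finset.mul_sum]
  refine Finset.sum_congr rfl fun y _ => ?_
  rw [bSymbol, map_mul, Complex.conj_conj, ← waveMinus_eq_conj]
  ring

variable [G.LocallyFinite]

theorem measurable_bSymbol [MeasurableSpace V] [DiscreteMeasurableSpace V]
    (hX : IsHomogeneousTree G q) {σ : V × Boundary G o × Set.Icc (0 : ℝ) (tau q) → ℂ}
    (hσ : Measurable σ) : Measurable (bSymbol q σ) := by
  have := countable_of_isHomogeneousTree hX
  refine measurable_from_prod_countable_right fun x => ?_
  exact (Complex.continuous_conj.measurable.comp (hσ.comp measurable_prodMk_left)).mul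
    (measurable_wavePlus_subtype hX x)

theorem lintegral_bSymbol [MeasurableSpace V] [DiscreteMeasurableSpace V]
    (hX : IsHomogeneousTree G q) {σ : V × Boundary G o × Set.Icc (0 : ℝ) (tau q) → ℂ}
    (hσ : Measurable σ) :
    ∫⁻ p, ‖bSymbol q σ p‖ₑ ^ 2
      ∂(Measure.count.prod ((boundaryMeasure hX o).prod (plancherelMeasure q))) =
    ∑' x, ∫⁻ p, ‖bSymbol q σ (x, p)‖ₑ ^ 2
      ∂((boundaryMeasure hX o).prod (plancherelMeasure q)) := by
  have := isFiniteMeasure_plancherelMeasure hX.two_le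
  have := countable_of_isHomogeneousTree hX
  rw [lintegral_prod _ ((measurable_bSymbol hX hσ).enorm.pow_const 2).aemeasurable,
    lintegral_count]

theorem IsPdo.integrable_conj_bSymbol {hX : IsHomogeneousTree G q}
    {σ : V × Boundary G o × Set.Icc (0 : ℝ) (tau q) → ℂ} {T : EllTwo V →L[ℂ] EllTwo V}
    (hT : IsPdo hX σ T) (x : V) : Integrable (fun p => conj (bSymbol q σ (x, p)))
      ((boundaryMeasure hX o).prod (plancherelMeasure q)) := by
  refine (hT.1 (Finsupp.single o 1) x).congr (Eventually.of_forall fun p => ?_)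
  simp [pdoIntegrand_eq_sum, wavePlus_root hX.isTree]

/-- The matrix entries of `T_σ` are the coefficients of `b(x, ·)` with respect to the plane
waves. -/
theorem IsPdo.apply_ellTwoBasis {hX : IsHomogeneousTree G q}
    {σ : V × Boundary G o × Set.Icc (0 : ℝ) (tau q) → ℂ} {T : EllTwo V →L[ℂ] EllTwo V}
    (hT : IsPdo hX σ T) (x y : V) : T (ellTwoBasis V y) x =
      ∫ p, conj (bSymbol q σ (x, p)) * wavePlus q p.1 p.2 y
        ∂((boundaryMeasure hX o).prod (plancherelMeasure q)) := by
  classical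
  rw [hT.2 (Finsupp.single y 1) (ellTwoBasis V y) (fun z => by
    rw [ellTwoBasis_apply, Finsupp.single_apply]; simp [eq_comm]) x, pdo]
  simp [pdoIntegrand_eq_sum]

theorem IsPdo.lintegral_bSymbol_eq [MeasurableSpace V] [DiscreteMeasurableSpace V]
    {hX : IsHomogeneousTree G q} {σ : V × Boundary G o × Set.Icc (0 : ℝ) (tau q) → ℂ}
    (hσ : Measurable σ) {T : EllTwo V →L[ℂ] EllTwo V} (hT : IsPdo hX σ T) :
    ∫⁻ p, ‖bSymbol q σ p‖ₑ ^ 2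
      ∂(Measure.count.prod ((boundaryMeasure hX o).prod (plancherelMeasure q))) =
    ∑' y, ‖T (ellTwoBasis V y)‖ₑ ^ 2 := by
  simp_rw [lintegral_bSymbol hX hσ, EllTwo.enorm_sq_eq_tsum, hT.apply_ellTwoBasis]
  rw [ENNReal.tsum_comm]
  refine tsum_congr fun x => ?_
  rw [← lintegral_enorm_sq_eq_tsum hX (hT.integrable_conj_bSymbol x)]
  simp_rw [RCLike.enorm_conj]

/-- If `b` is square integrable, then `T_σ` is the operator whose rows are the coefficient sequences
of the functions `b(x, ·)` with respect to the plane waves. -/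
theorem exists_isPdo_of_lintegral_ne_top [MeasurableSpace V] [DiscreteMeasurableSpace V]
    (hX : IsHomogeneousTree G q) {σ : V × Boundary G o × Set.Icc (0 : ℝ) (tau q) → ℂ}
    (hσ : Measurable σ) (hb : ∫⁻ p, ‖bSymbol q σ p‖ₑ ^ 2
      ∂(Measure.count.prod ((boundaryMeasure hX o).prod (plancherelMeasure q))) ≠ ∞) :
    ∃ T : EllTwo V →L[ℂ] EllTwo V, IsPdo hX σ T := by
  have := isFiniteMeasure_plancherelMeasure hX.two_le
  rw [lintegral_bSymbol hX hσ] at hb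
  have hL2 : ∀ x, MemLp (fun p => bSymbol q σ (x, p)) 2
      ((boundaryMeasure hX o).prod (plancherelMeasure q)) := fun x => by
    refine ⟨((measurable_bSymbol hX hσ).comp measurable_prodMk_left).aestronglyMeasurable, ?_⟩
    exact eLpNorm_two_lt_top_iff.2 (ENNReal.ne_top_of_tsum_ne_top hb x)
  have hint : ∀ x y, Integrable (fun p => conj (bSymbol q σ (x, p)) * wavePlus q p.1 p.2 y)
      ((boundaryMeasure hX o).prod (plancherelMeasure q)) := fun x y =>
    integrable_mul_wavePlus hX (integrable_conj ((hL2 x).integrable (by norm_num))) y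
  obtain ⟨e, he⟩ := exists_hilbertBasis_wavePlus hX o
  have hsum : Summable fun x => ‖e.repr (hL2 x).toLp‖ ^ 2 := by
    refine (ENNReal.summable_toReal hb).congr fun x => ?_
    rw [LinearIsometryEquiv.norm_map, Lp.norm_toLp, ← eLpNorm_two_sq, ENNReal.toReal_pow]
  obtain ⟨T, hT⟩ := exists_clm_of_summable_rows (fun x => e.repr (hL2 x).toLp) hsum
  refine ⟨T, fun f x => ?_, fun f g hg x => ?_⟩
  · simp_rw [funext (pdoIntegrand_eq_sum σ f x)]
    exact integrable_finsetSum _ fun y _ => (hint x y).const_mul _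
  · rw [hT, lp.inner_eq_tsum, tsum_eq_sum (s := f.support), pdo]
    · simp_rw [pdoIntegrand_eq_sum]
      rw [integral_finsetSum _ fun y _ => (hint x y).const_mul _]
      refine Finset.sum_congr rfl fun y _ => ?_
      rw [hg, RCLike.inner_apply, integral_const_mul, e.repr_apply_apply, inner_conj_symm,
        L2.inner_def]
      congr 1
      refine integral_congr_ae ?_
      filter_upwards [he y, (hL2 x).coeFn_toLp] with p hp hx
      rw [hp, hx, RCLike.inner_apply, mul_comm]
    · intro y hy
      rw [hg, Finsupp.notMem_support_iff.1 hy, inner_zero_right]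

end Operator
end

theorem mainTheorem3 {V : Type*} [MeasurableSpace V] [DiscreteMeasurableSpace V]
    (G : SimpleGraph V) [G.LocallyFinite] (q : ℕ) (hX : IsHomogeneousTree G q) (o : V)
    (σ : V × Boundary G o × Set.Icc (0 : ℝ) (tau q) → ℂ) (hσ : Measurable σ) :
    ((∃ T : EllTwo V →L[ℂ] EllTwo V, IsPdo hX σ T ∧ IsHilbertSchmidt T) ↔
      MemLp (bSymbol q σ) 2
        (Measure.count.prod ((boundaryMeasure hX o).prod (plancherelMeasure q)))) ∧
    ∀ T : EllTwo V →L[ℂ] EllTwo V, IsPdo hX σ T → IsHilbertSchmidt T →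
      schattenNorm 2 T =
        eLpNorm (bSymbol q σ) 2
          (Measure.count.prod ((boundaryMeasure hX o).prod (plancherelMeasure q))) := by
  have hsum : ∀ T : EllTwo V →L[ℂ] EllTwo V, IsPdo hX σ T → IsCompactOperator T →
      schattenSum 2 T = eLpNorm (bSymbol q σ) 2
        (Measure.count.prod ((boundaryMeasure hX o).prod (plancherelMeasure q))) ^ 2 := by
    intro T hT hc
    rw [schattenSum_two_eq_tsum hc (ellTwoBasis V), ← hT.lintegral_bSymbol_eq hσ, eLpNorm_two_sq]
  refine ⟨⟨?_, fun hb => ?_⟩, fun T hT hHS => ?_⟩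
  · rintro ⟨T, hT, hc, hlt⟩
    refine ⟨(measurable_bSymbol hX hσ).aestronglyMeasurable, ?_⟩
    rw [hsum T hT hc, eLpNorm_two_sq] at hlt
    exact eLpNorm_two_lt_top_iff.2 hlt.ne
  · have hfin := eLpNorm_two_lt_top_iff.1 hb.2
    obtain ⟨T, hT⟩ := exists_isPdo_of_lintegral_ne_top hX hσ hfin
    have hc := isCompactOperator_of_tsum_enorm_sq_ne_top (ellTwoBasis V) T
      (hT.lintegral_bSymbol_eq hσ ▸ hfin)
    exact ⟨T, hT, hc, by rw [hsum T hT hc]; exact ENNReal.pow_lt_top hb.2⟩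
  · rw [schattenNorm, hsum T hT hHS.1, ← ENNReal.rpow_natCast, ← ENNReal.rpow_mul]
    norm_num
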